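/- All graphs are finite and simple. A graph $G$ is \emph{$B_1$-ENPG} if there are a grid (the Cartesian product of two finite paths) and a family $(P_v)_{v\in V(G)}$ of simple paths in it, each with at most one bend, such that distinct vertices $u,v$ are adjacent in $G$ if and only if $P_u$ and $P_v$ have a common edge and no vertex has degree at least $3$ in $P_u\cup P_v$. A \emph{bend} of a path in a grid is an internal vertex of the path at which one incident edge of the path is horizontal and the other is vertical. Let $G=C(K,K',E)$ be a connected co-bipartite graph, i.e. $V(G)$ is the disjoint union of two cliques $K,K'$, and $E$ is the set of edges of $G$ between $K$ and $K'$. Let $G$ be twin-free, i.e. there are no two adjacent vertices $u,v$ with $N_G(u)\setminus\{v\}=N_G(v)\setminus\{u\}$. Let $G_B=B(K,K',E)$ be the bipartite graph with sides $K,K'$ and edge set $E$. A graph is a \emph{difference graph} if there are a real $T>0$ and a real number $a_v$ with $|a_v|<T$ for each vertex $v$ such that vertices $u,v$ are adjacent if and only if $|a_u-a_v|\ge T$. A \emph{zed} is a graph isomorphic to an induced subgraph of the path $P_4$ on four vertices ($P_4$ included). A non-empty set $M\subseteq K\cup K'$ is a \emph{bimodule} of $G_B$ if no vertex of $K\setminus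 M$ has both a neighbour and a non-neighbour (in $G_B$) in $M\cap K'$, and no vertex of $K'\setminus M$ has both a neighbour and a non-neighbour in $M\cap K$. A connected component is \emph{non-trivial} if it has at least two vertices. \textbf{Theorem.} $G$ is $B_1$-ENPG if and only if at least one of the following holds: \begin{enumerate} \item[i)] $G_B$ has at most two non-trivial connected components, each of which is a difference graph; \item[ii)] there is a set $Z\subseteq V(G)$ such that $G[Z]$ is a zed, $Z$ is a bimodule of $G_B$, and $G_B\setminus Z$ is a difference graph. \end{enumerate} -/

import Mathlib

open SimpleGraph

namespace ENPG

/-- A (simple) path in a host graph `H`, with arbitrary endpoints. -/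
structure PathIn {U : Type*} (H : SimpleGraph U) where
  source : U
  target : U
  walk : H.Walk source target
  isPath : walk.IsPath

/-- The splits of two paths: the vertices having degree at least `3` in the union of the paths. -/
def splits {U : Type*} {H : SimpleGraph U} (P Q : PathIn H) : Set U :=
  {x | 3 ≤ ((P.walk.toSubgraph ⊔ Q.walk.toSubgraph).neighborSet x).encard}

/-- `P ∼ Q`: the two paths have a common edge and do not split. -/
def NonSplitting {U : Type*} {H : SimpleGraph U} (P Q : PathIn H) : Prop :=
  (∃ e, e ∈ P.walk.edges ∧ e ∈ Q.walk.edges) ∧ splits P Q = ∅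

/-- The `m × n` grid graph: the Cartesian product of two paths on `m` and `n` vertices. -/
abbrev grid (m n : ℕ) : SimpleGraph (Fin m × Fin n) := pathGraph m □ pathGraph n

/-- The bends of a path in a grid: the vertices of the path that are incident, within the path,
to a horizontal and to a vertical edge (such a vertex is necessarily internal). -/
def bends {m n : ℕ} (P : PathIn (grid m n)) : Set (Fin m × Fin n) :=
  {x | ∃ y z, s(x, y) ∈ P.walk.edges ∧ s(x, z) ∈ P.walk.edges ∧ y.2 = x.2 ∧ z.1 = x.1}

/-- `G` is a `B_k`-ENPG graph: it is the graph of edge-intersecting, non-splitting pairs of a family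
of paths in a grid, each having at most `k` bends. -/
def IsBendENPG {V : Type*} (k : ℕ) (G : SimpleGraph V) : Prop :=
  ∃ (m n : ℕ) (P : V → PathIn (grid m n)),
    (∀ v, (bends (P v)).encard ≤ k) ∧
    ∀ u v, u ≠ v → (G.Adj u v ↔ NonSplitting (P u) (P v))

/-- No two adjacent vertices have the same neighbours apart from each other. -/
def TwinFree {V : Type*} (G : SimpleGraph V) : Prop :=
  ∀ u v, G.Adj u v → G.neighborSet u \ {v} ≠ G.neighborSet v \ {u}

/-- Difference graphs (also called bipartite chain graphs). -/
def IsDifferenceGraph {V : Type*} (G : SimpleGraph V) : Prop :=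
  ∃ (a : V → ℝ) (T : ℝ), 0 < T ∧ (∀ v, |a v| < T) ∧ ∀ u v, G.Adj u v ↔ T ≤ |a u - a v|

/-- A zed is a graph isomorphic to an induced subgraph of `P₄` (possibly `P₄` itself). -/
def IsZed {V : Type*} (G : SimpleGraph V) : Prop :=
  Nonempty (G ↪g pathGraph 4)

/-- In a bipartite graph `B` with bipartition `X, Y`, the vertex `v`, outside `M`, has both a
neighbour and a non-neighbour in the part of `M` on the side opposite to `v`. -/
def Distinguishes {V : Type*} (B : SimpleGraph V) (X Y : Set V) (v : V) (M : Set V) : Prop :=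
  (v ∈ X \ M ∧ (∃ w ∈ M ∩ Y, B.Adj v w) ∧ ∃ w ∈ M ∩ Y, ¬ B.Adj v w) ∨
  (v ∈ Y \ M ∧ (∃ w ∈ M ∩ X, B.Adj v w) ∧ ∃ w ∈ M ∩ X, ¬ B.Adj v w)

/-- A bimodule of a bipartite graph `B` with bipartition `X, Y`. -/
def IsBimodule {V : Type*} (B : SimpleGraph V) (X Y : Set V) (M : Set V) : Prop :=
  M.Nonempty ∧ M ⊆ X ∪ Y ∧ ∀ v, ¬ Distinguishes B X Y v M

end ENPG

/-!
Paths in a grid are replaced by their sets of lattice edges, and a path with at most one bend is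
an *elbow*, given by four integers (`exists_elbow_of_walk`, `exists_pathIn_elbow`). Two paths are
adjacent when their edge sets are `Linked`: they share an edge, and their union has no branching
vertex. Explicit criteria in terms of the integers (`linked_same_row`, `linked_rows_of_lt`,
`linked_row_col`) reduce the geometry to linear arithmetic.

The elbows of a clique are pairwise linked, which forces all pairs to share a horizontal edge, or
all pairs to share a vertical edge; by the one-dimensional Helly theorem they then have a common
*core* edge (`exists_core`). So each of `K` and `K'` has a core, and an adjacency between `u ∈ K`
and `v ∈ K'` comes from an overlap of the two paths on a route from one core to the other. There
are two possibilities, depending on the position of the cores (`routes_of_cores`).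

* Cores in different parallel lines (`TwoRoutes`). The common edges lie on the legs beyond the
  bends, and a path with one bend has only one leg. So there are at most two routes, each vertex
  uses at most one of them, and on a route adjacency means that two intervals growing towards each
  other overlap, which is a chain. This is the same as having at most two non-trivial components,
  all difference graphs.
* Cores in one line, or in two crossing lines (`SingleRoute`). There is one route. The paths that
  end before the far core form a chain. A path that runs past the far core overlaps every path
  that it could be adjacent to, so that only forks at the two ends of the route decide about its
  adjacencies. These vertices form a bimodule; without twins there are at most two of them in each
  clique, according to the fork at the near end, and they induce a subgraph of the path on four
  vertices.

Conversely both relations are realized by explicit paths, with lengths given by integer thresholds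
of the chains (`exists_thresholds`): a single row for `SingleRoute`, and two `U`-shapes facing
each other for `TwoRoutes`. Thus `SingleRoute` corresponds to the condition on zeds
(`HasZedBimodule`) and `TwoRoutes` to the condition on components (`TwoDifferenceComponents`).
-/

namespace ENPG

/-! ### Sets of lattice edges -/

/-- A set of edges of the infinite grid `ℤ × ℤ`: `h x y` says that the edge from `(x, y)` to
`(x + 1, y)` belongs to it, and `v x y` that the edge from `(x, y)` to `(x, y + 1)` does. -/
@[ext] structure LatticeEdges where
  h : ℤ → ℤ → Prop
  v : ℤ → ℤ → Prop

namespace LatticeEdges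

/-- The two edge sets have a common edge. -/
def Meets (E F : LatticeEdges) : Prop :=
  ∃ x y, E.h x y ∧ F.h x y ∨ E.v x y ∧ F.v x y

/-- At least three of the four edges at `(x, y)` belong to the edge set: both edges of one direction
and one of the other direction. -/
def Branches (E : LatticeEdges) (x y : ℤ) : Prop :=
  E.h x y ∧ E.h (x - 1) y ∧ (E.v x y ∨ E.v x (y - 1)) ∨
  E.v x y ∧ E.v x (y - 1) ∧ (E.h x y ∨ E.h (x - 1) y)

/-- The union of two edge sets. -/
def union (E F : LatticeEdges) : LatticeEdges :=
  ⟨fun x y => E.h x y ∨ F.h x y, fun x y => E.v x y ∨ F.v x y⟩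

/-- The edge sets have a common edge, and no vertex has degree at least `3` in their union. -/
def Linked (E F : LatticeEdges) : Prop :=
  E.Meets F ∧ ∀ x y, ¬ (E.union F).Branches x y

/-- The mirror image under `(x, y) ↦ (y, x)`. -/
def transpose (E : LatticeEdges) : LatticeEdges :=
  ⟨fun x y => E.v y x, fun x y => E.h y x⟩

/-- The mirror image under `(x, y) ↦ (-x, y)`. -/
def reflect (E : LatticeEdges) : LatticeEdges :=
  ⟨fun x y => E.h (-x - 1) y, fun x y => E.v (-x) y⟩

/-- The horizontal segment of row `y` from column `l` to column `r`, prolonged by vertical legs of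
signed lengths `a` in column `l` and `b` in column `r`. -/
def rowPath (y l r a b : ℤ) : LatticeEdges where
  h x z := z = y ∧ l ≤ x ∧ x < r
  v x z := x = l ∧ (y ≤ z ∧ z < y + a ∨ y + a ≤ z ∧ z < y) ∨
    x = r ∧ (y ≤ z ∧ z < y + b ∨ y + b ≤ z ∧ z < y)

/-- The vertical segment of column `x` from row `l` to row `r`, prolonged by horizontal legs. -/
def colPath (x l r a b : ℤ) : LatticeEdges := (rowPath x l r a b).transpose

theorem Meets.symm {E F : LatticeEdges} : E.Meets F → F.Meets E := by
  rintro ⟨x, y, h⟩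
  exact ⟨x, y, h.imp And.symm And.symm⟩

theorem union_comm (E F : LatticeEdges) : E.union F = F.union E := by
  ext <;> simp [union, or_comm]

theorem Linked.symm {E F : LatticeEdges} (h : E.Linked F) : F.Linked E :=
  ⟨h.1.symm, by rw [union_comm]; exact h.2⟩

theorem linked_comm {E F : LatticeEdges} : E.Linked F ↔ F.Linked E := ⟨.symm, .symm⟩

theorem Linked.transpose {E F : LatticeEdges} (h : E.Linked F) :
    E.transpose.Linked F.transpose := by
  obtain ⟨⟨x, y, hm⟩, hb⟩ := h
  exact ⟨⟨y, x, hm.symm⟩, fun x y hxy => hb y x hxy.symm⟩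

theorem linked_transpose {E F : LatticeEdges} :
    E.transpose.Linked F.transpose ↔ E.Linked F := ⟨fun h => h.transpose, .transpose⟩

theorem reflect_reflect (E : LatticeEdges) : E.reflect.reflect = E := by
  ext <;> simp [reflect]

theorem Linked.reflect {E F : LatticeEdges} (h : E.Linked F) : E.reflect.Linked F.reflect := by
  obtain ⟨⟨x, y, hm⟩, hb⟩ := h
  constructor
  · rcases hm with hm | hm
    · exact ⟨-x - 1, y, .inl (by simpa [LatticeEdges.reflect] using hm)⟩
    · exact ⟨-x, y, .inr (by simpa [LatticeEdges.reflect] using hm)⟩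
  · intro x y hxy
    apply hb (-x) y
    have e : -(x - 1) - 1 = -x := by ring
    simp only [Branches, union, LatticeEdges.reflect, e] at hxy ⊢
    exact hxy.imp (fun h => ⟨h.2.1, h.1, h.2.2⟩) (fun h => ⟨h.1, h.2.1, h.2.2.symm⟩)

theorem linked_reflect {E F : LatticeEdges} : E.reflect.Linked F.reflect ↔ E.Linked F :=
  ⟨fun h => by simpa only [reflect_reflect] using h.reflect, .reflect⟩

theorem reflect_rowPath (y l r a b : ℤ) :
    (rowPath y l r a b).reflect = rowPath y (-r) (-l) b a := by
  ext x z <;> simp only [rowPath, reflect] <;> omega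

theorem reflect_colPath (x l r a b : ℤ) :
    (colPath x l r a b).reflect = colPath (-x) l r (-a) (-b) := by
  ext y z <;> simp only [rowPath, colPath, transpose, reflect] <;> omega

/-! ### When two row paths are linked -/

theorem rowPath_v_base {y l r a b x : ℤ} :
    (rowPath y l r a b).v x y ↔ x = l ∧ 0 < a ∨ x = r ∧ 0 < b := by
  simp only [rowPath]; omega

theorem rowPath_v_base_sub_one {y l r a b x : ℤ} :
    (rowPath y l r a b).v x (y - 1) ↔ x = l ∧ a < 0 ∨ x = r ∧ b < 0 := by
  simp only [rowPath]; omega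

theorem rowPath_h {y l r a b x z : ℤ} :
    (rowPath y l r a b).h x z ↔ z = y ∧ l ≤ x ∧ x < r := Iff.rfl

/-- Two segments of one row that have right ends `r`, `r'` and overlap left of them, prolonged by
vertical legs of signed lengths `b`, `b'` at these ends, branch at the right end of the overlap. -/
def EndFork (r b r' b' : ℤ) : Prop :=
  b ≠ 0 ∧ r < r' ∨ b' ≠ 0 ∧ r' < r ∨ r = r' ∧ (0 < b ∧ b' < 0 ∨ b < 0 ∧ 0 < b')

theorem linked_same_row {y l r a b l' r' a' b' x x' : ℤ} (hx : x ≤ x') (hl : l ≤ x) (hr : x < r)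
    (hl' : l' ≤ x') (hr' : x' < r') :
    (rowPath y l r a b).Linked (rowPath y l' r' a' b') ↔
      l' < r ∧ ¬ EndFork (-l) a (-l') a' ∧ ¬ EndFork r b r' b' := by
  constructor
  · rintro ⟨⟨p, q, hm⟩, hb⟩
    have key (x : ℤ) := hb x y
    clear hb
    simp only [Branches, union, rowPath_v_base, rowPath_v_base_sub_one, rowPath_h, true_and]
      at key
    have hlr : l' < r := by
      simp only [rowPath] at hm
      by_contra hc
      obtain rfl : r = l' := by omega
      refine key r (.inl ⟨by omega, by omega, ?_⟩)
      clear key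
      rcases lt_trichotomy b 0 with hb | rfl | hb <;> omega
    clear hm
    refine ⟨hlr, ?_, ?_⟩
    · rintro (h | h | h)
      · exact key l (.inl ⟨by omega, by omega, by omega⟩)
      · exact key l' (.inl ⟨by omega, by omega, by omega⟩)
      · exact key l (.inr ⟨by omega, by omega, by omega⟩)
    · rintro (h | h | h)
      · exact key r (.inl ⟨by omega, by omega, by omega⟩)
      · exact key r' (.inl ⟨by omega, by omega, by omega⟩)
      · exact key r (.inr ⟨by omega, by omega, by omega⟩)
  · rintro ⟨h1, h2, h3⟩
    constructor
    · exact ⟨max l l', y, .inl (by simp only [rowPath, true_and]; omega)⟩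
    · simp only [Branches, union, rowPath_h, EndFork] at *
      rintro p q (⟨h, h', hv⟩ | ⟨hv, hv', h⟩)
      · obtain rfl : q = y := by omega
        simp only [rowPath_v_base, rowPath_v_base_sub_one] at hv
        omega
      · obtain rfl : q = y := by omega
        simp only [rowPath_v_base, rowPath_v_base_sub_one] at hv hv'
        omega

/-- Row paths in different rows can only share edges of their legs. They are linked when the legs
lie in the same column, point towards each other and overlap, without reaching past the other
row. -/
theorem linked_rows_of_lt {y l r a b y' l' r' a' b' : ℤ} (hy : y < y') (hl : l < r) (hl' : l' < r')
    (hab : a = 0 ∨ b = 0) (hab' : a' = 0 ∨ b' = 0) :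
    (rowPath y l r a b).Linked (rowPath y' l' r' a' b') ↔
      (if a ≠ 0 then l else r) = (if a' ≠ 0 then l' else r') ∧
        0 < a + b ∧ a + b ≤ y' - y ∧ a' + b' < 0 ∧ -(a' + b') ≤ y' - y ∧
        y' - y < (a + b) - (a' + b') := by
  have leg {y l r a b : ℤ} (hab : a = 0 ∨ b = 0) (x z : ℤ) : (rowPath y l r a b).v x z ↔
      x = (if a ≠ 0 then l else r) ∧ (y ≤ z ∧ z < y + (a + b) ∨ y + (a + b) ≤ z ∧ z < y) := by
    simp only [rowPath]
    split_ifs <;> omega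
  have col {l r a : ℤ} : (if a ≠ 0 then l else r) = l ∨ (if a ≠ 0 then l else r) = r := by
    split_ifs <;> simp
  have hc := col (l := l) (r := r) (a := a)
  have hc' := col (l := l') (r := r') (a := a')
  simp only [Linked, Meets, Branches, union, leg hab, leg hab', rowPath_h]
  generalize a + b = t at *
  generalize a' + b' = t' at *
  generalize (if a ≠ 0 then l else r) = c at *
  generalize (if a' ≠ 0 then l' else r') = c' at *
  clear leg col hab hab'
  constructor
  · rintro ⟨⟨p, q, hm⟩, hb⟩
    have hpc : p = c ∧ p = c' := by omega
    obtain ⟨rfl, rfl⟩ := hpc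
    have h1 : y + t ≤ y' := by
      by_contra h
      exact hb p y' (.inr ⟨by omega, by omega, by omega⟩)
    have h2 : y ≤ y' + t' := by
      by_contra h
      exact hb p y (.inr ⟨by omega, by omega, by omega⟩)
    clear hb
    omega
  · rintro ⟨rfl, h1, h2, h3, h4, h5⟩
    refine ⟨⟨c, y' + t', .inr (by omega)⟩, ?_⟩
    rintro p q (⟨h, h', hv⟩ | ⟨hv, hv', h⟩)
    · omega
    · omega

/-- A row path with its core left of column `x'` and a column path in column `x'` with its core
below row `y` can only share edges along the corner `(x', y)`. Measured along this corner, the row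
path reaches forward to `r - x' - b` and the column path backward to `y - z + t`. -/
theorem linked_row_col {y x l r a b x' y' d z s t : ℤ} (hx : x < x') (hy : y' < y) (hl : l ≤ x)
    (hr : x < r) (hd : d ≤ y') (hz : y' < z) (hab : a = 0 ∨ b = 0) (hst : s = 0 ∨ t = 0) :
    (rowPath y l r a b).Linked (colPath x' d z s t) ↔
      (b = 0 ∧ r ≤ x' ∨ r = x' ∧ b < 0) ∧ (t = 0 ∧ z ≤ y ∨ z = y ∧ t < 0) ∧
      y - z + t < r - x' - b ∧ ¬ (a ≠ 0 ∧ y - z + t < l - x') ∧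
      ¬ (s ≠ 0 ∧ y - d < r - x' - b) := by
  simp only [Linked, Meets, Branches, union, colPath, transpose, rowPath]
  constructor
  · rintro ⟨⟨p, q, hm⟩, hb⟩
    have hcross : ¬ (x' < r ∧ y ≤ z) := fun h =>
      hb x' y (.inl ⟨by omega, by omega, .inr (.inr (by omega))⟩)
    have hcross' : ¬ (x' ≤ r ∧ y < z) := fun h =>
      hb x' y (.inr ⟨by omega, by omega, .inr (.inl (by omega))⟩)
    have hcase : z = y ∧ t < 0 ∧ x' + t < r ∧ r ≤ x' ∨
        r = x' ∧ b < 0 ∧ y + b < z ∧ z ≤ y := by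
      clear hb
      rcases hm with hm | hm <;> omega
    clear hm hcross hcross'
    rcases hcase with ⟨rfl, ht, htr, hrx⟩ | ⟨rfl, hb0, hbz, hzy⟩
    · have h1 : b = 0 ∨ r = x' ∧ b < 0 := by
        by_contra h
        rcases hrx.lt_or_eq with h' | rfl
        · exact hb r z (.inl ⟨by omega, by omega, by omega⟩)
        · exact hb r z (.inr ⟨by omega, by omega, by omega⟩)
      have h2 : ¬ (a ≠ 0 ∧ x' + t < l) := fun h =>
        hb l z (.inl ⟨by omega, by omega, by omega⟩)
      have h3 : ¬ (s ≠ 0 ∧ z - d < r - x' - b) := fun h =>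
        hb x' d (.inr ⟨by omega, by omega, by omega⟩)
      clear hb
      omega
    · have h1 : t = 0 ∨ z = y ∧ t < 0 := by
        by_contra h
        rcases hzy.lt_or_eq with h' | rfl
        · exact hb r z (.inr ⟨by omega, by omega, by omega⟩)
        · exact hb r z (.inl ⟨by omega, by omega, by omega⟩)
      have h2 : ¬ (a ≠ 0 ∧ z = y ∧ r + t < l) := fun h =>
        hb l z (.inl ⟨by omega, by omega, by omega⟩)
      have h3 : ¬ (s ≠ 0 ∧ y + b < d) := fun h =>
        hb r d (.inr ⟨by omega, by omega, by omega⟩)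
      clear hb
      omega
  · rintro ⟨h1, h2, h3, h4, h5⟩
    constructor
    · rcases h2 with h2 | h2
      · exact ⟨x', max d (y + b), .inr (by omega)⟩
      · exact ⟨max l (x' + t), y, .inl (by omega)⟩
    · rintro p q (⟨h, h', hv⟩ | ⟨hv, hv', h⟩)
      · rcases h1 with ⟨rfl, h1⟩ | ⟨rfl, h1⟩ <;> rcases h2 with ⟨rfl, h2⟩ | ⟨rfl, h2⟩ <;> omega
      · rcases h1 with ⟨rfl, h1⟩ | ⟨rfl, h1⟩ <;> rcases h2 with ⟨rfl, h2⟩ | ⟨rfl, h2⟩ <;> omega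

end LatticeEdges
/-! ### The two shapes of the adjacency between the cliques -/

/-- Neighbourhoods are nested: the relation `C` between `K` and `K'` contains no two independent
pairs. -/
def IsChainOn {V : Type*} (K K' : Set V) (C : V → V → Prop) : Prop :=
  ∀ u₁ ∈ K, ∀ u₂ ∈ K, ∀ v₁ ∈ K', ∀ v₂ ∈ K', C u₁ v₁ → C u₂ v₂ → C u₁ v₂ ∨ C u₂ v₁

/-- The relation `R` between `K` and `K'` that arises when all common edges lie along one route
from the core of `K` to the core of `K'`. Here `C u v` says that the paths of `u` and `v` overlap
on the route, `α u ∧ γ v` that they fork at the end where the core of `K` lies, and `ρ u ∧ β v`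
that they fork at the other end. The last two clauses say that a path running past the far core
meets every path of the other clique, except where a fork rules out the adjacency anyway. -/
def SingleRoute {V : Type*} (K K' : Set V) (R : V → V → Prop) : Prop :=
  ∃ (C : V → V → Prop) (α γ ρ β : V → Prop), IsChainOn K K' C ∧
    ∀ u ∈ K, ∀ v ∈ K', (R u v ↔ C u v ∧ ¬ (α u ∧ γ v) ∧ ¬ (ρ u ∧ β v)) ∧
      (ρ u → C u v ∨ β v) ∧ (γ v → C u v ∨ α u)

/-- The relation `R` between `K` and `K'` that arises when there may be two routes from the core of
`K` to the core of `K'`: every vertex uses only one of them, and `R` is a chain on each. -/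
def TwoRoutes {V : Type*} (K K' : Set V) (R : V → V → Prop) : Prop :=
  ∃ σ τ : V → Prop, (∀ u ∈ K, ∀ v ∈ K', R u v → (σ u ↔ τ v)) ∧
    ∀ u₁ ∈ K, ∀ u₂ ∈ K, ∀ v₁ ∈ K', ∀ v₂ ∈ K', (σ u₁ ↔ σ u₂) → R u₁ v₁ → R u₂ v₂ →
      R u₁ v₂ ∨ R u₂ v₁

theorem SingleRoute.swap {V : Type*} {K K' : Set V} {R : V → V → Prop}
    (h : SingleRoute K K' R) : SingleRoute K' K (fun v u => R u v) := by
  obtain ⟨C, α, γ, ρ, β, hC, h⟩ := h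
  refine ⟨fun v u => C u v, β, ρ, γ, α, ?_, fun v hv u hu => ?_⟩
  · intro v₁ hv₁ v₂ hv₂ u₁ hu₁ u₂ hu₂ h₁ h₂
    exact (hC u₁ hu₁ u₂ hu₂ v₁ hv₁ v₂ hv₂ h₁ h₂).symm
  · have := h u hu v hv
    tauto

theorem TwoRoutes.swap {V : Type*} {K K' : Set V} {R : V → V → Prop}
    (h : TwoRoutes K K' R) : TwoRoutes K' K (fun v u => R u v) := by
  obtain ⟨σ, τ, h₁, h₂⟩ := h
  refine ⟨τ, σ, fun v hv u hu h => (h₁ u hu v hv h).symm, ?_⟩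
  intro v₁ hv₁ v₂ hv₂ u₁ hu₁ u₂ hu₂ hτ hR₁ hR₂
  refine (h₂ u₁ hu₁ u₂ hu₂ v₁ hv₁ v₂ hv₂ ?_ hR₁ hR₂).symm
  rw [h₁ u₁ hu₁ v₁ hv₁ hR₁, h₁ u₂ hu₂ v₂ hv₂ hR₂, hτ]

theorem SingleRoute.congr {V : Type*} {K K' : Set V} {R R' : V → V → Prop}
    (h : SingleRoute K K' R) (hR : ∀ u ∈ K, ∀ v ∈ K', R' u v ↔ R u v) :
    SingleRoute K K' R' := by
  obtain ⟨C, α, γ, ρ, β, hC, h⟩ := h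
  refine ⟨C, α, γ, ρ, β, hC, fun u hu v hv => ?_⟩
  rw [hR u hu v hv]
  exact h u hu v hv

theorem TwoRoutes.congr {V : Type*} {K K' : Set V} {R R' : V → V → Prop}
    (h : TwoRoutes K K' R) (hR : ∀ u ∈ K, ∀ v ∈ K', R' u v ↔ R u v) : TwoRoutes K K' R' := by
  obtain ⟨σ, τ, h₁, h₂⟩ := h
  refine ⟨σ, τ, fun u hu v hv => ?_, fun u₁ hu₁ u₂ hu₂ v₁ hv₁ v₂ hv₂ => ?_⟩
  · rw [hR u hu v hv]
    exact h₁ u hu v hv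
  · rw [hR u₁ hu₁ v₁ hv₁, hR u₂ hu₂ v₂ hv₂, hR u₁ hu₁ v₂ hv₂, hR u₂ hu₂ v₁ hv₁]
    exact h₂ u₁ hu₁ u₂ hu₂ v₁ hv₁ v₂ hv₂

namespace LatticeEdges

/-! ### Families with core edges on a common route -/

/-- All paths of the family contain the core edge from `(x, y)` to `(x + 1, y)`, and at most one
end of the horizontal segment of each carries a leg. -/
def HasRowCore {V : Type*} (K : Set V) (P : V → LatticeEdges) (y x : ℤ) : Prop :=
  ∃ l r a b : V → ℤ, ∀ u ∈ K, P u = rowPath y (l u) (r u) (a u) (b u) ∧ l u ≤ x ∧ x < r u ∧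
    (a u = 0 ∨ b u = 0)

/-- All paths of the family contain the core edge from `(x, y)` to `(x, y + 1)`. -/
def HasColCore {V : Type*} (K : Set V) (P : V → LatticeEdges) (x y : ℤ) : Prop :=
  HasRowCore K (fun u => (P u).transpose) x y

/-- Whether `u` and `v` fork factors through a condition on `u` and one on `v`, because no two
members of the same family fork. -/
theorem endFork_of_endFork {r b r₀ b₀ r' b' r₀' b₀' : ℤ} (h : ¬ EndFork r b r₀ b₀)
    (h' : ¬ EndFork r' b' r₀' b₀') (h₁ : EndFork r b r₀' b₀') (h₂ : EndFork r₀ b₀ r' b') :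
    EndFork r b r' b' := by
  simp only [EndFork] at *
  rcases h₁ with h₁ | h₁ | h₁ <;> rcases h₂ with h₂ | h₂ | h₂ <;> omega

/-- When both cores lie in one row, the route is the part of the row between them. -/
theorem HasRowCore.singleRoute_of_le {V : Type*} {K K' : Set V} {P : V → LatticeEdges}
    {y x x' : ℤ} (hK : HasRowCore K P y x) (hK' : HasRowCore K' P y x') (hx : x ≤ x')
    (hl : ∀ u ∈ K, ∀ v ∈ K, (P u).Linked (P v)) (hl' : ∀ u ∈ K', ∀ v ∈ K', (P u).Linked (P v)) :
    SingleRoute K K' (fun u v => (P u).Linked (P v)) := by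
  obtain ⟨l, r, a, b, hK⟩ := hK
  obtain ⟨l', r', a', b', hK'⟩ := hK'
  have fork : ∀ u ∈ K, ∀ v ∈ K, ¬ EndFork (-l u) (a u) (-l v) (a v) ∧
      ¬ EndFork (r u) (b u) (r v) (b v) := fun u hu v hv => by
    obtain ⟨e, h1, h2, -⟩ := hK u hu
    obtain ⟨e', h1', h2', -⟩ := hK v hv
    have := hl u hu v hv
    rw [e, e', linked_same_row le_rfl h1 h2 h1' h2'] at this
    exact this.2
  have fork' : ∀ u ∈ K', ∀ v ∈ K', ¬ EndFork (-l' u) (a' u) (-l' v) (a' v) ∧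
      ¬ EndFork (r' u) (b' u) (r' v) (b' v) := fun u hu v hv => by
    obtain ⟨e, h1, h2, -⟩ := hK' u hu
    obtain ⟨e', h1', h2', -⟩ := hK' v hv
    have := hl' u hu v hv
    rw [e, e', linked_same_row le_rfl h1 h2 h1' h2'] at this
    exact this.2
  refine ⟨fun u v => l' v < r u, fun u => ∃ v ∈ K', EndFork (-l u) (a u) (-l' v) (a' v),
    fun v => ∃ u ∈ K, EndFork (-l u) (a u) (-l' v) (a' v),
    fun u => ∃ v ∈ K', EndFork (r u) (b u) (r' v) (b' v),
    fun v => ∃ u ∈ K, EndFork (r u) (b u) (r' v) (b' v), ?_, fun u hu v hv => ⟨?_, ?_, ?_⟩⟩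
  · intro u₁ _ u₂ _ v₁ _ v₂ _ h₁ h₂
    dsimp only at *
    omega
  · obtain ⟨e, h1, h2, -⟩ := hK u hu
    obtain ⟨e', h1', h2', -⟩ := hK' v hv
    dsimp only
    rw [e, e', linked_same_row hx h1 h2 h1' h2']
    refine and_congr_right fun _ => and_congr (not_congr ⟨fun h => ⟨⟨v, hv, h⟩, u, hu, h⟩, ?_⟩)
      (not_congr ⟨fun h => ⟨⟨v, hv, h⟩, u, hu, h⟩, ?_⟩)
    · rintro ⟨⟨v₀, hv₀, h₁⟩, u₀, hu₀, h₂⟩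
      exact endFork_of_endFork (fork u hu u₀ hu₀).1 (fork' v hv v₀ hv₀).1 h₁ h₂
    · rintro ⟨⟨v₀, hv₀, h₁⟩, u₀, hu₀, h₂⟩
      exact endFork_of_endFork (fork u hu u₀ hu₀).2 (fork' v hv v₀ hv₀).2 h₁ h₂
  · rintro ⟨v₀, hv₀, h⟩
    by_contra! hc
    refine hc.2 u hu ?_
    have := hK' v hv
    have := hK' v₀ hv₀
    simp only [EndFork] at h ⊢
    omega
  · rintro ⟨u₀, hu₀, h⟩
    by_contra! hc
    refine hc.2 v hv ?_
    have := hK u hu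
    have := hK u₀ hu₀
    simp only [EndFork] at h ⊢
    omega

/-- When the cores lie in different rows, all common edges lie on legs. The two routes correspond to
the legs of `K` at left ends and at right ends, since those at left ends share one column, and so do
those at right ends. -/
theorem HasRowCore.twoRoutes_of_lt {V : Type*} {K K' : Set V} {P : V → LatticeEdges}
    {y y' x x' : ℤ} (hK : HasRowCore K P y x) (hK' : HasRowCore K' P y' x') (hy : y < y')
    (hl : ∀ u ∈ K, ∀ v ∈ K, (P u).Linked (P v)) :
    TwoRoutes K K' (fun u v => (P u).Linked (P v)) := by
  obtain ⟨l, r, a, b, hK⟩ := hK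
  obtain ⟨l', r', a', b', hK'⟩ := hK'
  have fork : ∀ u ∈ K, ∀ v ∈ K, ¬ EndFork (-l u) (a u) (-l v) (a v) ∧
      ¬ EndFork (r u) (b u) (r v) (b v) := fun u hu v hv => by
    obtain ⟨e, h1, h2, -⟩ := hK u hu
    obtain ⟨e', h1', h2', -⟩ := hK v hv
    have := hl u hu v hv
    rw [e, e', linked_same_row le_rfl h1 h2 h1' h2'] at this
    exact this.2
  have link : ∀ u ∈ K, ∀ v ∈ K', (P u).Linked (P v) ↔
      (if a u ≠ 0 then l u else r u) = (if a' v ≠ 0 then l' v else r' v) ∧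
        0 < a u + b u ∧ a u + b u ≤ y' - y ∧ a' v + b' v < 0 ∧ -(a' v + b' v) ≤ y' - y ∧
        y' - y < (a u + b u) - (a' v + b' v) := fun u hu v hv => by
    obtain ⟨e, h1, h2, h3⟩ := hK u hu
    obtain ⟨e', h1', h2', h3'⟩ := hK' v hv
    rw [e, e']
    exact linked_rows_of_lt hy (by omega) (by omega) h3 h3'
  refine ⟨fun u => a u ≠ 0, fun v => ∃ u ∈ K, (P u).Linked (P v) ∧ a u ≠ 0, ?_, ?_⟩
  · intro u hu v hv h
    dsimp only at *
    refine ⟨fun ha => ⟨u, hu, h, ha⟩, ?_⟩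
    rintro ⟨u₀, hu₀, h₀, ha₀⟩ ha
    rw [link u hu v hv, if_neg (not_not.2 ha)] at h
    rw [link u₀ hu₀ v hv, if_pos ha₀] at h₀
    have := hK u hu
    have := hK u₀ hu₀
    omega
  · intro u₁ hu₁ u₂ hu₂ v₁ hv₁ v₂ hv₂ hσ h₁ h₂
    dsimp only at *
    rw [link u₁ hu₁ v₁ hv₁] at h₁
    rw [link u₂ hu₂ v₂ hv₂] at h₂
    rw [link u₁ hu₁ v₂ hv₂, link u₂ hu₂ v₁ hv₁]
    have hcol : (if a u₁ ≠ 0 then l u₁ else r u₁) = if a u₂ ≠ 0 then l u₂ else r u₂ := by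
      have := fork u₁ hu₁ u₂ hu₂
      simp only [EndFork] at this
      have := hK u₁ hu₁
      have := hK u₂ hu₂
      by_cases ha : a u₁ ≠ 0
      · rw [if_pos ha, if_pos (hσ.1 ha)]
        have := hσ.1 ha
        omega
      · rw [if_neg ha, if_neg (fun h => ha (hσ.2 h))]
        have : ¬ a u₂ ≠ 0 := fun h => ha (hσ.2 h)
        omega
    omega

/-- When the cores lie in a row and a column, the route turns at their crossing. A path that bends
elsewhere on its way there, or passes the crossing, is linked to no path of the other family. -/
theorem HasRowCore.singleRoute_of_colCore {V : Type*} {K K' : Set V} {P : V → LatticeEdges}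
    {y x x' y' : ℤ} (hK : HasRowCore K P y x) (hK' : HasColCore K' P x' y') (hx : x < x')
    (hy : y' < y) (hl : ∀ u ∈ K, ∀ v ∈ K, (P u).Linked (P v))
    (hl' : ∀ u ∈ K', ∀ v ∈ K', (P u).Linked (P v)) :
    SingleRoute K K' (fun u v => (P u).Linked (P v)) := by
  obtain ⟨l, r, a, b, hK⟩ := hK
  obtain ⟨d, z, s, t, hK'⟩ := hK'
  have fork : ∀ u ∈ K, ∀ v ∈ K, a u ≠ 0 → a v ≠ 0 → l u = l v := fun u hu v hv ha ha' => by
    obtain ⟨e, h1, h2, -⟩ := hK u hu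
    obtain ⟨e', h1', h2', -⟩ := hK v hv
    have := hl u hu v hv
    rw [e, e', linked_same_row le_rfl h1 h2 h1' h2'] at this
    have := this.2.1
    simp only [EndFork] at this
    omega
  have fork' : ∀ u ∈ K', ∀ v ∈ K', s u ≠ 0 → s v ≠ 0 → d u = d v := fun u hu v hv ha ha' => by
    obtain ⟨e, h1, h2, -⟩ := hK' u hu
    obtain ⟨e', h1', h2', -⟩ := hK' v hv
    have := (hl' u hu v hv).transpose
    dsimp only at e e'
    rw [e, e', linked_same_row le_rfl h1 h2 h1' h2'] at this
    have := this.2.1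
    simp only [EndFork] at this
    omega
  have link : ∀ u ∈ K, ∀ v ∈ K', (P u).Linked (P v) ↔
      (b u = 0 ∧ r u ≤ x' ∨ r u = x' ∧ b u < 0) ∧ (t v = 0 ∧ z v ≤ y ∨ z v = y ∧ t v < 0) ∧
      y - z v + t v < r u - x' - b u ∧ ¬ (a u ≠ 0 ∧ y - z v + t v < l u - x') ∧
      ¬ (s v ≠ 0 ∧ y - d v < r u - x' - b u) := fun u hu v hv => by
    obtain ⟨e, h1, h2, h3⟩ := hK u hu
    obtain ⟨e', h1', h2', h3'⟩ := hK' v hv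
    have e' : P v = colPath x' (d v) (z v) (s v) (t v) := congrArg transpose e'
    rw [e, e']
    exact linked_row_col hx hy h1 h2 h1' h2' h3 h3'
  let good : V → Prop := fun u => b u = 0 ∧ r u ≤ x' ∨ r u = x' ∧ b u < 0
  let good' : V → Prop := fun v => t v = 0 ∧ z v ≤ y ∨ z v = y ∧ t v < 0
  refine ⟨fun u v => good u ∧ good' v ∧ y - z v + t v < r u - x' - b u,
    fun u => ¬ good u ∨ a u ≠ 0,
    fun v => good' v ∧ ∃ u ∈ K, a u ≠ 0 ∧ y - z v + t v < l u - x',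
    fun u => good u ∧ ∃ v ∈ K', s v ≠ 0 ∧ y - d v < r u - x' - b u,
    fun v => ¬ good' v ∨ s v ≠ 0, ?_, fun u hu v hv => ⟨?_, ?_, ?_⟩⟩
  · rintro u₁ _ u₂ _ v₁ _ v₂ _ ⟨g₁, g₁', h₁⟩ ⟨g₂, g₂', h₂⟩
    simp only [g₁, g₁', g₂, g₂', true_and]
    omega
  · dsimp only
    rw [link u hu v hv]
    constructor
    · rintro ⟨g, g', h₁, h₂, h₃⟩
      refine ⟨⟨g, g', h₁⟩, ?_, ?_⟩
      · rintro ⟨ha | ha, -, u₀, hu₀, ha₀, h⟩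
        · exact ha g
        · exact h₂ ⟨ha, fork u hu u₀ hu₀ ha ha₀ ▸ h⟩
      · rintro ⟨⟨-, v₀, hv₀, hs₀, h⟩, hs | hs⟩
        · exact hs g'
        · exact h₃ ⟨hs, fork' v hv v₀ hv₀ hs hs₀ ▸ h⟩
    · rintro ⟨⟨g, g', h₁⟩, h₂, h₃⟩
      exact ⟨g, g', h₁, fun h => h₂ ⟨.inr h.1, g', u, hu, h⟩, fun h => h₃ ⟨⟨g, v, hv, h⟩, .inr h.1⟩⟩
  · rintro ⟨g, v₀, hv₀, hs₀, h⟩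
    by_cases g' : good' v
    · refine .inl ⟨g, g', ?_⟩
      have := hK' v hv
      have := hK' v₀ hv₀
      simp only [good'] at g'
      omega
    · exact .inr (.inl g')
  · rintro ⟨g', u₀, hu₀, ha₀, h⟩
    by_cases g : good u
    · refine .inl ⟨g, g', ?_⟩
      have := hK u hu
      have := hK u₀ hu₀
      simp only [good] at g
      omega
    · exact .inr (.inl g)

/-! ### Cliques with a common core edge -/

theorem HasRowCore.reflect {V : Type*} {K : Set V} {P : V → LatticeEdges} {y x : ℤ}
    (h : HasRowCore K P y x) : HasRowCore K (fun u => (P u).reflect) y (-x - 1) := by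
  obtain ⟨l, r, a, b, h⟩ := h
  refine ⟨fun u => -r u, fun u => -l u, b, a, fun u hu => ?_⟩
  obtain ⟨e, h1, h2, h3⟩ := h u hu
  dsimp only
  exact ⟨by rw [e, reflect_rowPath], by omega, by omega, h3.symm⟩

theorem HasColCore.reflect {V : Type*} {K : Set V} {P : V → LatticeEdges} {x y : ℤ}
    (h : HasColCore K P x y) : HasColCore K (fun u => (P u).reflect) (-x) y := by
  obtain ⟨l, r, a, b, h⟩ := h
  refine ⟨l, r, fun u => -a u, fun u => -b u, fun u hu => ?_⟩
  obtain ⟨e, h1, h2, h3⟩ := h u hu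
  have e : P u = colPath x (l u) (r u) (a u) (b u) := congrArg transpose e
  dsimp only
  exact ⟨by rw [e, reflect_colPath]; rfl, h1, h2, by omega⟩

/-- Reflections move the core of the row family to the left of the column and the core of the
column family below the row. -/
theorem HasRowCore.singleRoute_of_hasColCore {V : Type*} {K K' : Set V} {P : V → LatticeEdges}
    {y x x' y' : ℤ} (hK : HasRowCore K P y x) (hK' : HasColCore K' P x' y')
    (hl : ∀ u ∈ K, ∀ v ∈ K, (P u).Linked (P v)) (hl' : ∀ u ∈ K', ∀ v ∈ K', (P u).Linked (P v)) :
    SingleRoute K K' (fun u v => (P u).Linked (P v)) := by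
  have left : ∀ {P : V → LatticeEdges} {x x' : ℤ}, x < x' → HasRowCore K P y x →
      HasColCore K' P x' y' → (∀ u ∈ K, ∀ v ∈ K, (P u).Linked (P v)) →
      (∀ u ∈ K', ∀ v ∈ K', (P u).Linked (P v)) →
      SingleRoute K K' (fun u v => (P u).Linked (P v)) := by
    intro P x x' hx hK hK' hl hl'
    rcases lt_or_ge y' y with hy | hy
    · exact hK.singleRoute_of_colCore hK' hx hy hl hl'
    · have hc : HasColCore K (fun u => (P u).transpose) y x := hK
      have := (HasRowCore.reflect hK').singleRoute_of_colCore hc.reflect (by omega) hx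
        (fun u hu v hv => (hl' u hu v hv).transpose.reflect)
        (fun u hu v hv => (hl u hu v hv).transpose.reflect)
      refine this.swap.congr fun u _ v _ => ?_
      rw [linked_reflect, linked_transpose, linked_comm]
  rcases lt_or_ge x x' with hx | hx
  · exact left hx hK hK' hl hl'
  · refine (left (by omega) hK.reflect hK'.reflect (fun u hu v hv => (hl u hu v hv).reflect)
      (fun u hu v hv => (hl' u hu v hv).reflect)).congr fun u _ v _ => ?_
    rw [linked_reflect]

theorem HasRowCore.routes_of_hasRowCore {V : Type*} {K K' : Set V} {P : V → LatticeEdges}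
    {y x y' x' : ℤ} (hK : HasRowCore K P y x) (hK' : HasRowCore K' P y' x')
    (hl : ∀ u ∈ K, ∀ v ∈ K, (P u).Linked (P v)) (hl' : ∀ u ∈ K', ∀ v ∈ K', (P u).Linked (P v)) :
    SingleRoute K K' (fun u v => (P u).Linked (P v)) ∨
      TwoRoutes K K' (fun u v => (P u).Linked (P v)) := by
  rcases lt_trichotomy y y' with hy | rfl | hy
  · exact .inr (hK.twoRoutes_of_lt hK' hy hl)
  · rcases le_total x x' with hx | hx
    · exact .inl (hK.singleRoute_of_le hK' hx hl hl')
    · exact .inl ((hK'.singleRoute_of_le hK hx hl' hl).swap.congr fun u _ v _ => linked_comm)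
  · exact .inr ((hK'.twoRoutes_of_lt hK hy hl').swap.congr fun u _ v _ => linked_comm)

theorem routes_of_cores {V : Type*} {K K' : Set V} {P : V → LatticeEdges}
    (hK : ∃ y x, HasRowCore K P y x ∨ HasColCore K P y x)
    (hK' : ∃ y x, HasRowCore K' P y x ∨ HasColCore K' P y x)
    (hl : ∀ u ∈ K, ∀ v ∈ K, (P u).Linked (P v)) (hl' : ∀ u ∈ K', ∀ v ∈ K', (P u).Linked (P v)) :
    SingleRoute K K' (fun u v => (P u).Linked (P v)) ∨
      TwoRoutes K K' (fun u v => (P u).Linked (P v)) := by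
  obtain ⟨y, x, hK | hK⟩ := hK <;> obtain ⟨y', x', hK' | hK'⟩ := hK'
  · exact hK.routes_of_hasRowCore hK' hl hl'
  · exact .inl (hK.singleRoute_of_hasColCore hK' hl hl')
  · exact .inl ((hK'.singleRoute_of_hasColCore hK hl' hl).swap.congr fun u _ v _ => linked_comm)
  · have := HasRowCore.routes_of_hasRowCore hK hK' (fun u hu v hv => (hl u hu v hv).transpose)
      (fun u hu v hv => (hl' u hu v hv).transpose)
    simpa only [linked_transpose] using this

/-! ### Elbows -/

/-- The elbow with corner `(p, q)`: a horizontal segment from the corner to `(s, q)` and a vertical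
one from the corner to `(p, t)`. Either may be degenerate. -/
def elbow (p q s t : ℤ) : LatticeEdges where
  h x y := y = q ∧ (p ≤ x ∧ x < s ∨ s ≤ x ∧ x < p)
  v x y := x = p ∧ (q ≤ y ∧ y < t ∨ t ≤ y ∧ y < q)

theorem transpose_elbow (p q s t : ℤ) : (elbow p q s t).transpose = elbow q p t s := rfl

theorem elbow_eq_rowPath (p q s t : ℤ) :
    elbow p q s t = rowPath q (min p s) (max p s) (if p < s then t - q else 0)
      (if p < s then 0 else t - q) := by
  ext x y
  · simp only [elbow, rowPath]; omega
  · simp only [elbow, rowPath]; split_ifs <;> omega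

/-- The edge sets have a common horizontal edge. -/
def MeetsRow (E F : LatticeEdges) : Prop := ∃ x y, E.h x y ∧ F.h x y

theorem meets_iff {E F : LatticeEdges} :
    E.Meets F ↔ E.MeetsRow F ∨ E.transpose.MeetsRow F.transpose := by
  simp only [Meets, MeetsRow, transpose, exists_or]
  exact or_congr Iff.rfl exists_comm

theorem meetsRow_elbow {p q s t p' q' s' t' : ℤ} :
    (elbow p q s t).MeetsRow (elbow p' q' s' t') ↔
      q = q' ∧ max (min p s) (min p' s') < min (max p s) (max p' s') := by
  constructor
  · rintro ⟨x, y, h⟩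
    simp only [elbow] at h
    omega
  · rintro ⟨rfl, h⟩
    refine ⟨max (min p s) (min p' s'), q, ?_⟩
    simp only [elbow, true_and]
    omega

/-- Two linked elbows with the same corner cannot turn into opposite directions there, so they
share edges of both segments. -/
theorem meetsRow_of_linked {p q s t s' t' : ℤ} (hl : (elbow p q s t).Linked (elbow p q s' t'))
    (hs : s ≠ p) (hs' : s' ≠ p) (ht : t ≠ q) : (elbow p q s t).MeetsRow (elbow p q s' t') := by
  rw [meetsRow_elbow]
  have := hl.2 p q
  by_contra hc
  refine this (.inl ?_)
  simp only [union, elbow, true_and]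
  omega

theorem linked_self_elbow {p q s t : ℤ} (h : p ≠ s ∨ q ≠ t) :
    (elbow p q s t).Linked (elbow p q s t) := by
  constructor
  · rcases h with h | h
    · exact ⟨min p s, q, .inl (by simp only [elbow, true_and]; omega)⟩
    · exact ⟨p, min q t, .inr (by simp only [elbow, true_and]; omega)⟩
  · rintro x y (⟨h, h', hv⟩ | ⟨hv, hv', h⟩) <;> simp only [union, elbow] at * <;> omega

/-- In a family of pairwise linked elbows, all pairs share a horizontal edge or all pairs share a
vertical edge: if `u₁, u₂` share no horizontal and `w₁, w₂` no vertical edge, then all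
four have the same corner, and some pair forks there. -/
theorem forall_meetsRow_or_forall_meetsRow_transpose {V : Type*} {K : Set V}
    {p q s t : V → ℤ}
    (hl : ∀ u ∈ K, ∀ v ∈ K,
      (elbow (p u) (q u) (s u) (t u)).Linked (elbow (p v) (q v) (s v) (t v))) :
    (∀ u ∈ K, ∀ v ∈ K,
      (elbow (p u) (q u) (s u) (t u)).MeetsRow (elbow (p v) (q v) (s v) (t v))) ∨
    ∀ u ∈ K, ∀ v ∈ K,
      (elbow (q u) (p u) (t u) (s u)).MeetsRow (elbow (q v) (p v) (t v) (s v)) := by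
  by_contra! hc
  obtain ⟨⟨u₁, hu₁, u₂, hu₂, hu⟩, w₁, hw₁, w₂, hw₂, hw⟩ := hc
  have meets : ∀ u ∈ K, ∀ v ∈ K,
      (elbow (p u) (q u) (s u) (t u)).MeetsRow (elbow (p v) (q v) (s v) (t v)) ∨
      (elbow (q u) (p u) (t u) (s u)).MeetsRow (elbow (q v) (p v) (t v) (s v)) :=
    fun u hu v hv => meets_iff.1 (hl u hu v hv).1
  have corner : ∀ u ∈ K, ∀ v ∈ K, p u = p v → q u = q v → s u ≠ p u → s v ≠ p v → t u ≠ q u →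
      (elbow (p u) (q u) (s u) (t u)).MeetsRow (elbow (p v) (q v) (s v) (t v)) :=
    fun u hu v hv e₁ e₂ h₁ h₂ h₃ => by
      have := hl u hu v hv
      rw [← e₁, ← e₂] at this ⊢
      exact meetsRow_of_linked this h₁ (e₁ ▸ h₂) h₃
  have corner' : ∀ u ∈ K, ∀ v ∈ K, p u = p v → q u = q v → t u ≠ q u → t v ≠ q v → s u ≠ p u →
      (elbow (q u) (p u) (t u) (s u)).MeetsRow (elbow (q v) (p v) (t v) (s v)) :=
    fun u hu v hv e₁ e₂ h₁ h₂ h₃ => by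
      have := (hl u hu v hv).transpose
      rw [transpose_elbow, transpose_elbow, ← e₁, ← e₂] at this
      rw [← e₁, ← e₂]
      exact meetsRow_of_linked this h₁ (e₂ ▸ h₂) h₃
  have row : ∀ u ∈ K, ∀ v ∈ K,
      (elbow (p u) (q u) (s u) (t u)).MeetsRow (elbow (p v) (q v) (s v) (t v)) →
      q u = q v ∧ s u ≠ p u ∧ s v ≠ p v := fun u _ v _ h => by
    rw [meetsRow_elbow] at h
    omega
  have col : ∀ u ∈ K, ∀ v ∈ K,
      (elbow (q u) (p u) (t u) (s u)).MeetsRow (elbow (q v) (p v) (t v) (s v)) →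
      p u = p v ∧ t u ≠ q u ∧ t v ≠ q v := fun u _ v _ h => by
    rw [meetsRow_elbow] at h
    omega
  have hu' := col u₁ hu₁ u₂ hu₂ ((meets u₁ hu₁ u₂ hu₂).resolve_left hu)
  have hw' := row w₁ hw₁ w₂ hw₂ ((meets w₁ hw₁ w₂ hw₂).resolve_right hw)
  have cu : ¬ (q u₁ = q u₂ ∧ s u₁ ≠ p u₁ ∧ s u₂ ≠ p u₂) := fun h =>
    hu (corner u₁ hu₁ u₂ hu₂ hu'.1 h.1 h.2.1 h.2.2 hu'.2.1)
  have cw : ¬ (p w₁ = p w₂ ∧ t w₁ ≠ q w₁ ∧ t w₂ ≠ q w₂) := fun h =>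
    hw (corner' w₁ hw₁ w₂ hw₂ h.1 hw'.1 h.2.1 h.2.2 hw'.2.1)
  have cases : ∀ u ∈ K, ∀ v ∈ K, (q u = q v ∧ s u ≠ p u ∧ s v ≠ p v) ∨
      (p u = p v ∧ t u ≠ q u ∧ t v ≠ q v) := fun u hu v hv =>
    (meets u hu v hv).imp (row u hu v hv) (col u hu v hv)
  have h11 := cases u₁ hu₁ w₁ hw₁
  have h12 := cases u₁ hu₁ w₂ hw₂
  have h21 := cases u₂ hu₂ w₁ hw₁
  have h22 := cases u₂ hu₂ w₂ hw₂
  obtain ⟨hp, -, -⟩ := hu'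
  obtain ⟨hq, -, -⟩ := hw'
  rcases h11 with ⟨e₁, a₁, b₁⟩ | ⟨e₁, a₁, b₁⟩
  · rcases h21 with ⟨e₂, a₂, b₂⟩ | ⟨e₂, a₂, b₂⟩
    · exact cu ⟨e₁.trans e₂.symm, a₁, a₂⟩
    · rcases h22 with ⟨e₃, a₃, b₃⟩ | ⟨e₃, a₃, b₃⟩
      · exact cu ⟨(e₁.trans hq).trans e₃.symm, a₁, a₃⟩
      · exact cw ⟨e₂.symm.trans e₃, b₂, b₃⟩
  · rcases h12 with ⟨e₂, a₂, b₂⟩ | ⟨e₂, a₂, b₂⟩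
    · rcases h22 with ⟨e₃, a₃, b₃⟩ | ⟨e₃, a₃, b₃⟩
      · exact cu ⟨e₂.trans e₃.symm, a₂, a₃⟩
      · exact cw ⟨e₁.symm.trans (hp.trans e₃), b₁, b₃⟩
    · exact cw ⟨e₁.symm.trans e₂, b₁, b₂⟩

/-- One-dimensional Helly: the intervals of a common row meet pairwise, so the edge at the
rightmost left end lies in all of them. -/
theorem exists_hasRowCore {V : Type*} [Finite V] {K : Set V} (hne : K.Nonempty) {p q s t : V → ℤ}
    {P : V → LatticeEdges} (hP : ∀ u ∈ K, P u = elbow (p u) (q u) (s u) (t u))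
    (h : ∀ u ∈ K, ∀ v ∈ K,
      (elbow (p u) (q u) (s u) (t u)).MeetsRow (elbow (p v) (q v) (s v) (t v))) :
    ∃ y x, HasRowCore K P y x := by
  obtain ⟨u₀, hu₀, hmax⟩ := K.toFinite.exists_maximalFor (fun u => min (p u) (s u)) K hne
  simp only [meetsRow_elbow] at h
  refine ⟨q u₀, min (p u₀) (s u₀), fun u => min (p u) (s u), fun u => max (p u) (s u),
    fun u => if p u < s u then t u - q u else 0, fun u => if p u < s u then 0 else t u - q u,
    fun u hu => ⟨?_, ?_, ?_, ?_⟩⟩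
  · rw [(h u₀ hu₀ u hu).1, hP u hu]
    exact elbow_eq_rowPath _ _ _ _
  · rcases le_total (min (p u) (s u)) (min (p u₀) (s u₀)) with h' | h'
    · exact h'
    · exact hmax hu h'
  · have := h u₀ hu₀ u hu
    dsimp only
    omega
  · dsimp only
    split_ifs <;> simp

theorem exists_core {V : Type*} [Finite V] {K : Set V} (hne : K.Nonempty) {p q s t : V → ℤ}
    {P : V → LatticeEdges} (hP : ∀ u ∈ K, P u = elbow (p u) (q u) (s u) (t u))
    (hl : ∀ u ∈ K, ∀ v ∈ K, (P u).Linked (P v)) :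
    ∃ y x, HasRowCore K P y x ∨ HasColCore K P y x := by
  have hl : ∀ u ∈ K, ∀ v ∈ K,
      (elbow (p u) (q u) (s u) (t u)).Linked (elbow (p v) (q v) (s v) (t v)) :=
    fun u hu v hv => by rw [← hP u hu, ← hP v hv]; exact hl u hu v hv
  rcases forall_meetsRow_or_forall_meetsRow_transpose hl with h | h
  · obtain ⟨y, x, h⟩ := exists_hasRowCore hne hP h
    exact ⟨y, x, .inl h⟩
  · obtain ⟨y, x, h⟩ := exists_hasRowCore (P := fun u => (P u).transpose) hne
      (fun u hu => by rw [hP u hu, transpose_elbow]) h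
    exact ⟨y, x, .inr h⟩

/-! ### From walks in a grid to elbows and back -/

/-- Both a horizontal and a vertical edge at `(x, y)` belong to the edge set. -/
def BendsAt (E : LatticeEdges) (x y : ℤ) : Prop :=
  (E.h x y ∨ E.h (x - 1) y) ∧ (E.v x y ∨ E.v x (y - 1))

/-- Some edge at `(x, y)` belongs to the edge set. -/
def Touches (E : LatticeEdges) (x y : ℤ) : Prop :=
  (E.h x y ∨ E.h (x - 1) y) ∨ (E.v x y ∨ E.v x (y - 1))

/-- An elbow that ends at `(i', j')`, prolonged there by an edge to a new vertex `(i, j)`, is again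
an elbow, provided that there is only one bend. -/
theorem exists_elbow_of_union {i j i' j' p q s t : ℤ}
    (hadj : (i = i' + 1 ∨ i' = i + 1) ∧ j = j' ∨ (j = j' + 1 ∨ j' = j + 1) ∧ i = i')
    (hend : i' = s ∧ j' = q ∨ i' = p ∧ j' = t)
    (hnew : ¬ (elbow p q s t).Touches i j)
    (hb : ∀ x y x' y', ((elbow i j i' j').union (elbow p q s t)).BendsAt x y →
      ((elbow i j i' j').union (elbow p q s t)).BendsAt x' y' → x = x' ∧ y = y') :
    ∃ p' q' s' t', (elbow i j i' j').union (elbow p q s t) = elbow p' q' s' t' ∧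
      (i = s' ∧ j = q' ∨ i = p' ∧ j = t') := by
  have main : ∀ {i j i' j' p q s t : ℤ},
      ((i = i' + 1 ∨ i' = i + 1) ∧ j = j' ∨ (j = j' + 1 ∨ j' = j + 1) ∧ i = i') →
      i' = s ∧ j' = q → ¬ (elbow p q s t).Touches i j →
      (∀ x y x' y', ((elbow i j i' j').union (elbow p q s t)).BendsAt x y →
        ((elbow i j i' j').union (elbow p q s t)).BendsAt x' y' → x = x' ∧ y = y') →
      ∃ p' q' s' t', (elbow i j i' j').union (elbow p q s t) = elbow p' q' s' t' ∧
        (i = s' ∧ j = q' ∨ i = p' ∧ j = t') := by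
    clear * -
    rintro i j i' j' p q s t hadj ⟨rfl, rfl⟩ hnew hb
    rcases hadj with ⟨hi, rfl⟩ | ⟨hj, rfl⟩
    · refine ⟨p, j, i, t, ?_, .inl ⟨rfl, rfl⟩⟩
      simp only [Touches, elbow, true_and] at hnew
      ext x y <;> simp only [union, elbow] <;> omega
    · by_cases hp : p = i
      · subst hp
        refine ⟨p, j, p, t, ?_, .inl ⟨rfl, rfl⟩⟩
        simp only [Touches, elbow, true_and] at hnew
        ext x y <;> simp only [union, elbow] <;> omega
      · -- The walk bends at its old end, so the elbow cannot have a bend at its corner.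
        have ht : t = j' := by
          by_contra ht
          refine hp (hb p j' i j' ?_ ?_).1
          · simp only [BendsAt, union, elbow, true_and]; omega
          · simp only [BendsAt, union, elbow, true_and]; omega
        subst ht
        refine ⟨i, t, p, j, ?_, .inr ⟨rfl, rfl⟩⟩
        ext x y <;> simp only [union, elbow] <;> omega
  rcases hend with hend | hend
  · exact main hadj hend hnew hb
  · obtain ⟨p', q', s', t', h, h'⟩ := main (i := j) (j := i) (i' := j') (j' := i') (p := q) (q := p)
      (s := t) (t := s) hadj.symm hend.symm (fun h => hnew h.symm)
      (fun x y x' y' h h' => (hb y x y' x' h.symm h'.symm).symm)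
    exact ⟨q', p', t', s', congrArg transpose h, h'.symm.imp And.symm And.symm⟩

/-- The set of lattice edges given by a set of edges on `Fin m × Fin n`. -/
def ofEdges {m n : ℕ} (E : Set (Sym2 (Fin m × Fin n))) : LatticeEdges where
  h x y := ∃ a b, s(a, b) ∈ E ∧ (a.1 : ℤ) = x ∧ (b.1 : ℤ) = x + 1 ∧ (a.2 : ℤ) = y ∧ (b.2 : ℤ) = y
  v x y := ∃ a b, s(a, b) ∈ E ∧ (a.1 : ℤ) = x ∧ (b.1 : ℤ) = x ∧ (a.2 : ℤ) = y ∧ (b.2 : ℤ) = y + 1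

theorem grid_adj_iff {m n : ℕ} {a b : Fin m × Fin n} : (grid m n).Adj a b ↔
    (((a.1 : ℤ) = b.1 + 1 ∨ (b.1 : ℤ) = a.1 + 1) ∧ (a.2 : ℤ) = b.2) ∨
    (((a.2 : ℤ) = b.2 + 1 ∨ (b.2 : ℤ) = a.2 + 1) ∧ (a.1 : ℤ) = b.1) := by
  simp only [boxProd_adj, pathGraph_adj, Fin.ext_iff]
  omega

theorem point_ext {m n : ℕ} {a b : Fin m × Fin n} (h₁ : (a.1 : ℤ) = b.1)
    (h₂ : (a.2 : ℤ) = b.2) : a = b :=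
  Prod.ext (Fin.ext (by omega)) (Fin.ext (by omega))

theorem ofEdges_union {m n : ℕ} (E F : Set (Sym2 (Fin m × Fin n))) :
    ofEdges (E ∪ F) = (ofEdges E).union (ofEdges F) := by
  ext x y <;> simp only [ofEdges, union, Set.mem_union, or_and_right, exists_or]

theorem ofEdges_singleton {m n : ℕ} {a b : Fin m × Fin n} (h : (grid m n).Adj a b) :
    ofEdges {s(a, b)} = elbow a.1 a.2 b.1 b.2 := by
  rw [grid_adj_iff] at h
  ext x y
  · simp only [ofEdges, elbow, Set.mem_singleton_iff, Sym2.eq_iff]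
    constructor
    · rintro ⟨c, d, ⟨rfl, rfl⟩ | ⟨rfl, rfl⟩, h'⟩ <;> omega
    · rintro ⟨rfl, h' | h'⟩
      · exact ⟨a, b, .inl ⟨rfl, rfl⟩, by omega⟩
      · exact ⟨b, a, .inr ⟨rfl, rfl⟩, by omega⟩
  · simp only [ofEdges, elbow, Set.mem_singleton_iff, Sym2.eq_iff]
    constructor
    · rintro ⟨c, d, ⟨rfl, rfl⟩ | ⟨rfl, rfl⟩, h'⟩ <;> omega
    · rintro ⟨rfl, h' | h'⟩
      · exact ⟨a, b, .inl ⟨rfl, rfl⟩, by omega⟩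
      · exact ⟨b, a, .inr ⟨rfl, rfl⟩, by omega⟩

theorem ofEdges_right {m n : ℕ} {E : Set (Sym2 (Fin m × Fin n))} (a : Fin m × Fin n) :
    (ofEdges E).h a.1 a.2 ↔ ∃ b, s(a, b) ∈ E ∧ (b.1 : ℤ) = a.1 + 1 ∧ (b.2 : ℤ) = a.2 := by
  constructor
  · rintro ⟨c, b, h, h1, h2, h3, h4⟩
    obtain rfl := point_ext h1 h3
    exact ⟨b, h, h2, h4⟩
  · rintro ⟨b, h, h1, h2⟩
    exact ⟨a, b, h, rfl, h1, rfl, h2⟩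

theorem ofEdges_left {m n : ℕ} {E : Set (Sym2 (Fin m × Fin n))} (a : Fin m × Fin n) :
    (ofEdges E).h (a.1 - 1) a.2 ↔ ∃ b, s(a, b) ∈ E ∧ (b.1 : ℤ) = a.1 - 1 ∧ (b.2 : ℤ) = a.2 := by
  constructor
  · rintro ⟨b, c, h, h1, h2, h3, h4⟩
    obtain rfl := point_ext (a := c) (b := a) (by omega) h4
    exact ⟨b, Sym2.eq_swap ▸ h, h1, h3⟩
  · rintro ⟨b, h, h1, h2⟩
    exact ⟨b, a, Sym2.eq_swap ▸ h, h1, by omega, h2, rfl⟩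

theorem ofEdges_up {m n : ℕ} {E : Set (Sym2 (Fin m × Fin n))} (a : Fin m × Fin n) :
    (ofEdges E).v a.1 a.2 ↔ ∃ b, s(a, b) ∈ E ∧ (b.1 : ℤ) = a.1 ∧ (b.2 : ℤ) = a.2 + 1 := by
  constructor
  · rintro ⟨c, b, h, h1, h2, h3, h4⟩
    obtain rfl := point_ext h1 h3
    exact ⟨b, h, h2, h4⟩
  · rintro ⟨b, h, h1, h2⟩
    exact ⟨a, b, h, rfl, h1, rfl, h2⟩

theorem ofEdges_down {m n : ℕ} {E : Set (Sym2 (Fin m × Fin n))} (a : Fin m × Fin n) :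
    (ofEdges E).v a.1 (a.2 - 1) ↔
      ∃ b, s(a, b) ∈ E ∧ (b.1 : ℤ) = a.1 ∧ (b.2 : ℤ) = a.2 - 1 := by
  constructor
  · rintro ⟨b, c, h, h1, h2, h3, h4⟩
    obtain rfl := point_ext (a := c) (b := a) h2 (by omega)
    exact ⟨b, Sym2.eq_swap ▸ h, h1, h3⟩
  · rintro ⟨b, h, h1, h2⟩
    exact ⟨b, a, Sym2.eq_swap ▸ h, h1, rfl, h2, by omega⟩

/-- Only grid points are touched. -/
theorem exists_point_of_touches {m n : ℕ} {E : Set (Sym2 (Fin m × Fin n))} {x y : ℤ}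
    (h : (ofEdges E).Touches x y) :
    ∃ a b : Fin m × Fin n, s(a, b) ∈ E ∧ (a.1 : ℤ) = x ∧ (a.2 : ℤ) = y := by
  rcases h with (⟨a, b, h, h1, h2, h3, h4⟩ | ⟨a, b, h, h1, h2, h3, h4⟩) |
    (⟨a, b, h, h1, h2, h3, h4⟩ | ⟨a, b, h, h1, h2, h3, h4⟩)
  · exact ⟨a, b, h, h1, h3⟩
  · exact ⟨b, a, Sym2.eq_swap ▸ h, by omega, h4⟩
  · exact ⟨a, b, h, h1, h3⟩
  · exact ⟨b, a, Sym2.eq_swap ▸ h, h2, by omega⟩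

theorem bendsAt_ofEdges {m n : ℕ} {E : Set (Sym2 (Fin m × Fin n))} (hE : E ⊆ (grid m n).edgeSet)
    (a : Fin m × Fin n) : (ofEdges E).BendsAt a.1 a.2 ↔
      ∃ b c, s(a, b) ∈ E ∧ s(a, c) ∈ E ∧ b.2 = a.2 ∧ c.1 = a.1 := by
  rw [BendsAt, ofEdges_right, ofEdges_left, ofEdges_up, ofEdges_down]
  constructor
  · rintro ⟨⟨b, hb, h1, h2⟩ | ⟨b, hb, h1, h2⟩, ⟨c, hc, h3, h4⟩ | ⟨c, hc, h3, h4⟩⟩ <;>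
      exact ⟨b, c, hb, hc, Fin.ext (by omega), Fin.ext (by omega)⟩
  · rintro ⟨b, c, hb, hc, h, h'⟩
    have h1 := (grid_adj_iff (a := a) (b := b)).1 (hE hb)
    have h2 := (grid_adj_iff (a := a) (b := c)).1 (hE hc)
    rw [Fin.ext_iff] at h h'
    constructor
    · rcases lt_or_ge (a.1 : ℤ) b.1 with h3 | h3
      · exact .inl ⟨b, hb, by omega, by omega⟩
      · exact .inr ⟨b, hb, by omega, by omega⟩
    · rcases lt_or_ge (a.2 : ℤ) c.2 with h3 | h3
      · exact .inl ⟨c, hc, by omega, by omega⟩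
      · exact .inr ⟨c, hc, by omega, by omega⟩

/-- Three of the four possible edges at a grid point always include two collinear ones, so
`Branches` expresses that the degree is at least three. -/
theorem branches_ofEdges {m n : ℕ} {E : Set (Sym2 (Fin m × Fin n))} (hE : E ⊆ (grid m n).edgeSet)
    (a : Fin m × Fin n) : (ofEdges E).Branches a.1 a.2 ↔ 3 ≤ {b | s(a, b) ∈ E}.encard := by
  have three : 3 ≤ {b | s(a, b) ∈ E}.encard ↔
      ∃ b c d, s(a, b) ∈ E ∧ s(a, c) ∈ E ∧ s(a, d) ∈ E ∧ b ≠ c ∧ b ≠ d ∧ c ≠ d := by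
    constructor
    · intro h
      obtain ⟨t, ht, h3⟩ := Set.exists_subset_encard_eq h
      obtain ⟨b, c, d, hbc, hbd, hcd, rfl⟩ := Set.encard_eq_three.1 h3
      exact ⟨b, c, d, ht (by simp), ht (by simp), ht (by simp), hbc, hbd, hcd⟩
    · rintro ⟨b, c, d, hb, hc, hd, hbc, hbd, hcd⟩
      rw [← Set.encard_eq_three.2 ⟨b, c, d, hbc, hbd, hcd, rfl⟩]
      apply Set.encard_le_encard
      rintro x (rfl | rfl | rfl) <;> assumption
  rw [three, Branches, ofEdges_right, ofEdges_left, ofEdges_up, ofEdges_down]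
  have ne {b c : Fin m × Fin n} (h : (b.1 : ℤ) ≠ c.1 ∨ (b.2 : ℤ) ≠ c.2) : b ≠ c := by
    rintro rfl
    simp at h
  constructor
  · rintro (⟨⟨b, hb, h1, h2⟩, ⟨c, hc, h3, h4⟩, ⟨d, hd, h5, h6⟩ | ⟨d, hd, h5, h6⟩⟩ |
      ⟨⟨b, hb, h1, h2⟩, ⟨c, hc, h3, h4⟩, ⟨d, hd, h5, h6⟩ | ⟨d, hd, h5, h6⟩⟩) <;>
    exact ⟨b, c, d, hb, hc, hd, ne (by omega), ne (by omega), ne (by omega)⟩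
  · rintro ⟨b, c, d, hb, hc, hd, hbc, hbd, hcd⟩
    have dir : ∀ b, s(a, b) ∈ E →
        (((b.1 : ℤ) = a.1 + 1 ∧ (b.2 : ℤ) = a.2 ∨ (b.1 : ℤ) = a.1 - 1 ∧ (b.2 : ℤ) = a.2) ∨
        ((b.1 : ℤ) = a.1 ∧ (b.2 : ℤ) = a.2 + 1 ∨ (b.1 : ℤ) = a.1 ∧ (b.2 : ℤ) = a.2 - 1)) :=
      fun b hb => by
        have := (grid_adj_iff (a := a) (b := b)).1 (hE hb)
        omega
    -- Record along with each direction that the corresponding edge exists.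
    replace dir : ∀ b, s(a, b) ∈ E →
        ((((b.1 : ℤ) = a.1 + 1 ∧ (b.2 : ℤ) = a.2) ∧
            ∃ b, s(a, b) ∈ E ∧ (b.1 : ℤ) = a.1 + 1 ∧ (b.2 : ℤ) = a.2) ∨
          (((b.1 : ℤ) = a.1 - 1 ∧ (b.2 : ℤ) = a.2) ∧
            ∃ b, s(a, b) ∈ E ∧ (b.1 : ℤ) = a.1 - 1 ∧ (b.2 : ℤ) = a.2)) ∨
        ((((b.1 : ℤ) = a.1 ∧ (b.2 : ℤ) = a.2 + 1) ∧
            ∃ b, s(a, b) ∈ E ∧ (b.1 : ℤ) = a.1 ∧ (b.2 : ℤ) = a.2 + 1) ∨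
          (((b.1 : ℤ) = a.1 ∧ (b.2 : ℤ) = a.2 - 1) ∧
            ∃ b, s(a, b) ∈ E ∧ (b.1 : ℤ) = a.1 ∧ (b.2 : ℤ) = a.2 - 1)) := fun b hb =>
      (dir b hb).imp (Or.imp (fun h => ⟨h, b, hb, h⟩) (fun h => ⟨h, b, hb, h⟩))
        (Or.imp (fun h => ⟨h, b, hb, h⟩) (fun h => ⟨h, b, hb, h⟩))
    have hb' := dir b hb
    have hc' := dir c hc
    have hd' := dir d hd
    have hbc' : ¬ ((b.1 : ℤ) = c.1 ∧ (b.2 : ℤ) = c.2) := fun h => hbc (point_ext h.1 h.2)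
    have hbd' : ¬ ((b.1 : ℤ) = d.1 ∧ (b.2 : ℤ) = d.2) := fun h => hbd (point_ext h.1 h.2)
    have hcd' : ¬ ((c.1 : ℤ) = d.1 ∧ (c.2 : ℤ) = d.2) := fun h => hcd (point_ext h.1 h.2)
    generalize (∃ b, s(a, b) ∈ E ∧ (b.1 : ℤ) = a.1 + 1 ∧ (b.2 : ℤ) = a.2) = R at *
    generalize (∃ b, s(a, b) ∈ E ∧ (b.1 : ℤ) = a.1 - 1 ∧ (b.2 : ℤ) = a.2) = L at *
    generalize (∃ b, s(a, b) ∈ E ∧ (b.1 : ℤ) = a.1 ∧ (b.2 : ℤ) = a.2 + 1) = U at *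
    generalize (∃ b, s(a, b) ∈ E ∧ (b.1 : ℤ) = a.1 ∧ (b.2 : ℤ) = a.2 - 1) = D at *
    clear dir three ne hb hc hd hbc hbd hcd hE
    rcases hb' with (⟨h1, h2⟩ | ⟨h1, h2⟩) | (⟨h1, h2⟩ | ⟨h1, h2⟩) <;>
    rcases hc' with (⟨h3, h4⟩ | ⟨h3, h4⟩) | (⟨h3, h4⟩ | ⟨h3, h4⟩) <;>
    rcases hd' with (⟨h5, h6⟩ | ⟨h5, h6⟩) | (⟨h5, h6⟩ | ⟨h5, h6⟩) <;>
    first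
    | (exfalso; omega)
    | simp only [h2, h4, h6, true_and, and_true, true_or, or_true]

theorem ofEdges_meets {m n : ℕ} {E F : Set (Sym2 (Fin m × Fin n))}
    (hE : E ⊆ (grid m n).edgeSet) :
    (ofEdges E).Meets (ofEdges F) ↔ ∃ e, e ∈ E ∧ e ∈ F := by
  constructor
  · rintro ⟨x, y, ⟨⟨a, b, h, h1, h2, h3, h4⟩, ⟨a', b', h', h1', h2', h3', h4'⟩⟩ |
      ⟨⟨a, b, h, h1, h2, h3, h4⟩, ⟨a', b', h', h1', h2', h3', h4'⟩⟩⟩ <;>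
    · obtain rfl := point_ext (a := a) (b := a') (by omega) (by omega)
      obtain rfl := point_ext (a := b) (b := b') (by omega) (by omega)
      exact ⟨_, h, h'⟩
  · rintro ⟨e, h, h'⟩
    induction e with
    | _ a b =>
    rcases (grid_adj_iff (a := a) (b := b)).1 (hE h) with ⟨h1 | h1, h2⟩ | ⟨h1 | h1, h2⟩
    · exact ⟨b.1, b.2, .inl ⟨(ofEdges_right b).2 ⟨a, Sym2.eq_swap ▸ h, h1, h2⟩,
        (ofEdges_right b).2 ⟨a, Sym2.eq_swap ▸ h', h1, h2⟩⟩⟩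
    · exact ⟨a.1, a.2, .inl ⟨(ofEdges_right a).2 ⟨b, h, h1, h2.symm⟩,
        (ofEdges_right a).2 ⟨b, h', h1, h2.symm⟩⟩⟩
    · exact ⟨b.1, b.2, .inr ⟨(ofEdges_up b).2 ⟨a, Sym2.eq_swap ▸ h, h2, h1⟩,
        (ofEdges_up b).2 ⟨a, Sym2.eq_swap ▸ h', h2, h1⟩⟩⟩
    · exact ⟨a.1, a.2, .inr ⟨(ofEdges_up a).2 ⟨b, h, h2.symm, h1⟩,
        (ofEdges_up a).2 ⟨b, h', h2.symm, h1⟩⟩⟩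

theorem Branches.touches {E : LatticeEdges} {x y : ℤ} (h : E.Branches x y) : E.Touches x y :=
  h.elim (fun h => .inl (.inl h.1)) (fun h => .inr (.inl h.1))

/-- The relation between paths in a grid only depends on their lattice edges. -/
theorem nonSplitting_iff_linked {m n : ℕ} (P Q : PathIn (grid m n)) : NonSplitting P Q ↔
    (ofEdges {e | e ∈ P.walk.edges}).Linked (ofEdges {e | e ∈ Q.walk.edges}) := by
  have hE : {e | e ∈ P.walk.edges} ⊆ (grid m n).edgeSet := P.walk.edges_subset_edgeSet
  have hF : {e | e ∈ Q.walk.edges} ⊆ (grid m n).edgeSet := Q.walk.edges_subset_edgeSet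
  refine and_congr (ofEdges_meets hE).symm ?_
  rw [← ofEdges_union, Set.eq_empty_iff_forall_notMem]
  have key (a : Fin m × Fin n) : a ∈ splits P Q ↔
      (ofEdges ({e | e ∈ P.walk.edges} ∪ {e | e ∈ Q.walk.edges})).Branches a.1 a.2 := by
    rw [branches_ofEdges (Set.union_subset hE hF), splits, Set.mem_ofPred_eq]
    congr! 2
    ext b
    simp [Subgraph.mem_neighborSet, Walk.adj_toSubgraph_iff_mem_edges]
  simp only [key]
  refine ⟨fun h x y hxy => ?_, fun h a => h _ _⟩
  obtain ⟨a, b, -, rfl, rfl⟩ := exists_point_of_touches hxy.touches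
  exact h a hxy

theorem ofEdges_cons {m n : ℕ} {a c b : Fin m × Fin n} (h : (grid m n).Adj a c)
    (w : (grid m n).Walk c b) : ofEdges {e | e ∈ (Walk.cons h w).edges} =
      (elbow a.1 a.2 c.1 c.2).union (ofEdges {e | e ∈ w.edges}) := by
  rw [← ofEdges_singleton h, ← ofEdges_union]
  congr 1
  ext e
  simp

theorem ofEdges_nil {m n : ℕ} (a : Fin m × Fin n) :
    ofEdges {e | e ∈ (Walk.nil : (grid m n).Walk a a).edges} = elbow a.1 a.2 a.1 a.2 := by
  ext x y <;> simp only [Walk.edges_nil, List.not_mem_nil, ofEdges, elbow, Set.ofPred_false,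
    Set.mem_empty_iff_false, false_and, exists_false, false_iff] <;> omega

/-- A path in a grid with at most one bend is an elbow, and starts at one of its two ends. -/
theorem exists_elbow_of_walk {m n : ℕ} {a b : Fin m × Fin n} (w : (grid m n).Walk a b)
    (hw : w.IsPath)
    (hb : ∀ x y x' y', (ofEdges {e | e ∈ w.edges}).BendsAt x y →
      (ofEdges {e | e ∈ w.edges}).BendsAt x' y' → x = x' ∧ y = y') :
    ∃ p q s t, ofEdges {e | e ∈ w.edges} = elbow p q s t ∧
      ((a.1 : ℤ) = s ∧ (a.2 : ℤ) = q ∨ (a.1 : ℤ) = p ∧ (a.2 : ℤ) = t) := by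
  induction w with
  | nil =>
    rename_i a
    exact ⟨a.1, a.2, a.1, a.2, ofEdges_nil a, .inl ⟨rfl, rfl⟩⟩
  | cons h w ih =>
    rename_i a c b
    rw [Walk.cons_isPath_iff] at hw
    rw [ofEdges_cons] at hb ⊢
    obtain ⟨p, q, s, t, e', hend⟩ := ih hw.1 fun x y x' y' h h' => hb x y x' y'
      (h.imp (Or.imp .inr .inr) (Or.imp .inr .inr)) (h'.imp (Or.imp .inr .inr) (Or.imp .inr .inr))
    have hnew : ¬ (ofEdges {e | e ∈ w.edges}).Touches a.1 a.2 := fun ht => by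
      obtain ⟨a', d, hd, h1, h2⟩ := exists_point_of_touches ht
      obtain rfl := point_ext h1 h2
      exact hw.2 (w.fst_mem_support_of_mem_edges hd)
    rw [e'] at hb hnew ⊢
    exact exists_elbow_of_union (grid_adj_iff.1 h) hend hnew hb

theorem BendsAt.touches {E : LatticeEdges} {x y : ℤ} (h : E.BendsAt x y) : E.Touches x y :=
  .inl h.1

theorem bends_encard_le_one_iff {m n : ℕ} (P : PathIn (grid m n)) : (bends P).encard ≤ 1 ↔
    ∀ x y x' y', (ofEdges {e | e ∈ P.walk.edges}).BendsAt x y →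
      (ofEdges {e | e ∈ P.walk.edges}).BendsAt x' y' → x = x' ∧ y = y' := by
  have hE : {e | e ∈ P.walk.edges} ⊆ (grid m n).edgeSet := P.walk.edges_subset_edgeSet
  rw [Set.encard_le_one_iff]
  constructor
  · intro h x y x' y' hxy hxy'
    obtain ⟨a, -, -, rfl, rfl⟩ := exists_point_of_touches hxy.touches
    obtain ⟨b, -, -, rfl, rfl⟩ := exists_point_of_touches hxy'.touches
    rw [h a b ((bendsAt_ofEdges hE a).1 hxy) ((bendsAt_ofEdges hE b).1 hxy')]
    exact ⟨rfl, rfl⟩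
  · intro h a b ha hb
    have := h _ _ _ _ ((bendsAt_ofEdges hE a).2 ha) ((bendsAt_ofEdges hE b).2 hb)
    exact point_ext this.1 this.2

/-- A walk from `a` along the elbow with corner `(p, q)`, ending in `(p, t)`. -/
def IsElbowWalk {m n : ℕ} {a b : Fin m × Fin n} (w : (grid m n).Walk a b) (p q t : ℤ) : Prop :=
  w.IsPath ∧ ofEdges {e | e ∈ w.edges} = elbow p q a.1 t ∧ ∀ c ∈ w.support,
    (c.2 : ℤ) = q ∧ min p a.1 ≤ (c.1 : ℤ) ∧ (c.1 : ℤ) ≤ max p a.1 ∨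
      (c.1 : ℤ) = p ∧ min q t ≤ (c.2 : ℤ) ∧ (c.2 : ℤ) ≤ max q t

theorem exists_isElbowWalk_vertical {m n : ℕ} {t : ℤ} (ht : 0 ≤ t) (htn : t < n) (d : ℕ) :
    ∀ a : Fin m × Fin n, ((a.2 : ℤ) - t).natAbs = d →
      ∃ (b : Fin m × Fin n) (w : (grid m n).Walk a b), IsElbowWalk w a.1 a.2 t := by
  induction d with
  | zero =>
    intro a ha
    obtain rfl : t = a.2 := by omega
    refine ⟨a, .nil, .nil, ofEdges_nil a, fun c hc => ?_⟩
    obtain rfl : c = a := by simpa using hc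
    omega
  | succ d ih =>
    intro a ha
    obtain ⟨y, hy⟩ : ∃ y : Fin n, (y : ℤ) = if (a.2 : ℤ) < t then (a.2 : ℤ) + 1 else a.2 - 1 :=
      ⟨⟨(if (a.2 : ℤ) < t then (a.2 : ℤ) + 1 else a.2 - 1).toNat, by split_ifs <;> omega⟩,
        by dsimp only; split_ifs <;> omega⟩
    obtain ⟨b, w, hw, he, hs⟩ := ih (a.1, y) (by dsimp only; split_ifs at hy <;> omega)
    have hadj : (grid m n).Adj a (a.1, y) := grid_adj_iff.2 (by
      dsimp only; split_ifs at hy <;> omega)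
    dsimp only at he hs
    refine ⟨b, .cons hadj w, ?_, ?_, ?_⟩
    · refine (Walk.cons_isPath_iff _ _).2 ⟨hw, fun h => ?_⟩
      have := hs a h
      split_ifs at hy <;> omega
    · rw [ofEdges_cons, he]
      dsimp only
      ext x z <;> simp only [union, elbow] <;> split_ifs at hy <;> omega
    · intro c hc
      rw [Walk.support_cons, List.mem_cons] at hc
      rcases hc with rfl | hc
      · omega
      · have := hs c hc
        split_ifs at hy <;> omega

theorem exists_isElbowWalk {m n : ℕ} {p t : ℤ} (hp : 0 ≤ p) (hpm : p < m) (ht : 0 ≤ t)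
    (htn : t < n) (d : ℕ) : ∀ a : Fin m × Fin n, ((a.1 : ℤ) - p).natAbs = d →
      ∃ (b : Fin m × Fin n) (w : (grid m n).Walk a b), IsElbowWalk w p a.2 t := by
  induction d with
  | zero =>
    intro a ha
    obtain rfl : p = a.1 := by omega
    exact exists_isElbowWalk_vertical ht htn _ a rfl
  | succ d ih =>
    intro a ha
    obtain ⟨x, hx⟩ : ∃ x : Fin m, (x : ℤ) = if (a.1 : ℤ) < p then (a.1 : ℤ) + 1 else a.1 - 1 :=
      ⟨⟨(if (a.1 : ℤ) < p then (a.1 : ℤ) + 1 else a.1 - 1).toNat, by split_ifs <;> omega⟩,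
        by dsimp only; split_ifs <;> omega⟩
    obtain ⟨b, w, hw, he, hs⟩ := ih (x, a.2) (by dsimp only; split_ifs at hx <;> omega)
    have hadj : (grid m n).Adj a (x, a.2) := grid_adj_iff.2 (by
      dsimp only; split_ifs at hx <;> omega)
    dsimp only at he hs
    refine ⟨b, .cons hadj w, ?_, ?_, ?_⟩
    · refine (Walk.cons_isPath_iff _ _).2 ⟨hw, fun h => ?_⟩
      have := hs a h
      split_ifs at hx <;> omega
    · rw [ofEdges_cons, he]
      dsimp only
      ext y z <;> simp only [union, elbow] <;> split_ifs at hx <;> omega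
    · intro c hc
      rw [Walk.support_cons, List.mem_cons] at hc
      rcases hc with rfl | hc
      · omega
      · have := hs c hc
        split_ifs at hx <;> omega

/-- Every elbow whose coordinates fit into the grid is a path with at most one bend. -/
theorem exists_pathIn_elbow {m n : ℕ} {p q s t : ℤ} (hp : 0 ≤ p) (hpm : p < m) (hq : 0 ≤ q)
    (hqn : q < n) (hs : 0 ≤ s) (hsm : s < m) (ht : 0 ≤ t) (htn : t < n) :
    ∃ P : PathIn (grid m n), (bends P).encard ≤ 1 ∧
      ofEdges {e | e ∈ P.walk.edges} = elbow p q s t := by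
  lift s to ℕ using hs
  lift q to ℕ using hq
  obtain ⟨b, w, hw, he, -⟩ := exists_isElbowWalk hp hpm ht htn _
    ((⟨s, by omega⟩, ⟨q, by omega⟩) : Fin m × Fin n) rfl
  refine ⟨⟨_, b, w, hw⟩, ?_, he⟩
  rw [bends_encard_le_one_iff]
  dsimp only
  rw [he]
  intro x y x' y' h h'
  simp only [BendsAt, elbow] at h h'
  omega

end LatticeEdges
/-! ### Chains and difference graphs -/

/-- Two edges of a difference graph are joined by a further edge. -/
theorem IsDifferenceGraph.adj_or_adj {V : Type*} {H : SimpleGraph V} (hH : IsDifferenceGraph H)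
    {u₁ u₂ v₁ v₂ : V} (h₁ : H.Adj u₁ v₁) (h₂ : H.Adj u₂ v₂) (hu : ¬ H.Adj u₁ u₂)
    (hv : ¬ H.Adj v₁ v₂) : H.Adj u₁ v₂ ∨ H.Adj u₂ v₁ := by
  obtain ⟨a, T, hT, ha, h⟩ := hH
  by_contra! hc
  simp only [h, le_abs, not_or, not_le] at h₁ h₂ hu hv hc
  obtain ⟨⟨h3, h4⟩, h5, h6⟩ := hc
  rcases h₁ with h₁ | h₁ <;> rcases h₂ with h₂ | h₂ <;> linarith

/-- A relation that is a chain on each of two parts is given there by integer thresholds: `f` counts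
neighbours, and `g v` is determined by the least degree of a neighbour of `v`. -/
theorem exists_thresholds {V : Type*} [Finite V] {K K' : Set V} {R : V → V → Prop}
    {σ τ : V → Prop} (hστ : ∀ u ∈ K, ∀ v ∈ K', R u v → (σ u ↔ τ v))
    (hR : ∀ u₁ ∈ K, ∀ u₂ ∈ K, ∀ v₁ ∈ K', ∀ v₂ ∈ K', (σ u₁ ↔ σ u₂) → R u₁ v₁ → R u₂ v₂ →
      R u₁ v₂ ∨ R u₂ v₁) :
    ∃ (N : ℕ) (f g : V → ℕ), 0 < N ∧ (∀ v, f v ≤ N) ∧ (∀ v, g v ≤ N) ∧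
      ∀ u ∈ K, ∀ v ∈ K', (σ u ↔ τ v) → (R u v ↔ N < f u + g v) := by
  classical
  have := Fintype.ofFinite V
  let nb : V → Finset V := fun u => {v | v ∈ K' ∧ R u v}
  let f : V → ℕ := fun u => (nb u).card
  let N := Fintype.card V + 1
  have hf : ∀ u, f u < N := fun u => Nat.lt_succ_of_le (Finset.card_le_univ _)
  refine ⟨N, f, fun v => ({u | u ∈ K ∧ v ∈ K' ∧ R u v} : Finset V).sup fun u => N + 1 - f u,
    by omega, fun u => (hf u).le, fun v => ?_, fun u hu v hv huv => ?_⟩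
  · refine Finset.sup_le fun u hu => ?_
    rw [Finset.mem_filter_univ] at hu
    have : 0 < f u := Finset.card_pos.2 ⟨v, by simp [nb, hu]⟩
    omega
  · have : N < f u + ({u | u ∈ K ∧ v ∈ K' ∧ R u v} : Finset V).sup (fun u => N + 1 - f u) ↔
        N - f u < ({u | u ∈ K ∧ v ∈ K' ∧ R u v} : Finset V).sup fun u => N + 1 - f u := by
      have := hf u
      omega
    rw [this, Finset.lt_sup_iff]
    simp only [Finset.mem_filter_univ]
    constructor
    · intro h
      exact ⟨u, ⟨hu, hv, h⟩, by have := hf u; omega⟩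
    · rintro ⟨u', ⟨hu', -, h'⟩, hlt⟩
      by_contra h
      have hle : f u' ≤ f u := by
        have := hf u
        have := hf u'
        omega
      have hv' : v ∈ nb u' := by simp [nb, hv, h']
      have hv'' : v ∉ nb u := by simp [nb, h]
      obtain ⟨w, hw, hw'⟩ : ∃ w ∈ nb u, w ∉ nb u' := by
        by_contra! hc
        exact hv'' (Finset.eq_of_subset_of_card_le hc hle ▸ hv')
      simp only [nb, Finset.mem_filter_univ] at hw hw'
      rcases hR u hu u' hu' w hw.1 v hv (huv.trans (hστ u' hu' v hv h').symm) hw.2 h' with h1 | h1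
      · exact h h1
      · exact hw' ⟨hw.1, h1⟩

theorem IsChainOn.isDifferenceGraph {W : Type*} [Finite W] {H : SimpleGraph W} {X : Set W}
    (hX : ∀ u v, H.Adj u v → (u ∈ X ↔ v ∉ X)) (hH : IsChainOn X Xᶜ H.Adj) :
    IsDifferenceGraph H := by
  classical
  obtain ⟨N, f, g, -, hf, hg, h⟩ := exists_thresholds (σ := fun _ => True) (τ := fun _ => True)
    (fun _ _ _ _ _ => Iff.rfl) (fun u₁ h1 u₂ h2 v₁ h3 v₂ h4 _ => hH u₁ h1 u₂ h2 v₁ h3 v₂ h4)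
  have hf' : ∀ v, (f v : ℝ) ≤ N := fun v => mod_cast hf v
  have hg' : ∀ v, (g v : ℝ) ≤ N := fun v => mod_cast hg v
  have hf0 : ∀ v, (0 : ℝ) ≤ f v := fun v => Nat.cast_nonneg _
  have hg0 : ∀ v, (0 : ℝ) ≤ g v := fun v => Nat.cast_nonneg _
  have cross : ∀ u ∈ X, ∀ v ∉ X, H.Adj u v ↔ (N + 1 : ℝ) ≤ |(f u : ℝ) - -(g v : ℝ)| := by
    intro u hu v hv
    rw [h u hu v hv Iff.rfl, sub_neg_eq_add, abs_of_nonneg (add_nonneg (hf0 u) (hg0 v))]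
    exact_mod_cast Iff.rfl
  refine ⟨fun v => if v ∈ X then (f v : ℝ) else -(g v : ℝ), N + 1, by positivity, fun v => ?_,
    fun u v => ?_⟩
  · dsimp only
    have := hf' v
    have := hg' v
    have := hf0 v
    have := hg0 v
    split_ifs <;> rw [abs_lt] <;> constructor <;> linarith
  · dsimp only
    have h1 := hf' u
    have h2 := hg' u
    have h3 := hf' v
    have h4 := hg' v
    have h5 := hf0 u
    have h6 := hg0 u
    have h7 := hf0 v
    have h8 := hg0 v
    by_cases hu : u ∈ X <;> by_cases hv : v ∈ X
    · rw [if_pos hu, if_pos hv]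
      refine iff_of_false (fun h => (hX u v h).1 hu hv) (not_le.2 ?_)
      rw [abs_lt]
      constructor <;> linarith
    · rw [if_pos hu, if_neg hv]
      exact cross u hu v hv
    · rw [if_neg hu, if_pos hv, H.adj_comm, abs_sub_comm]
      exact cross v hv u hu
    · rw [if_neg hu, if_neg hv]
      refine iff_of_false (fun h => hu ((hX u v h).2 hv)) (not_le.2 ?_)
      rw [abs_lt]
      constructor <;> linarith

/-! ### Representations -/

open LatticeEdges

theorem rowPath_eq_elbow {y l r a b : ℤ} (hlr : l < r) (hab : a = 0 ∨ b = 0) :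
    rowPath y l r a b = if a = 0 then elbow r y l (y + b) else elbow l y r (y + a) := by
  ext x z
  · split_ifs <;> simp only [elbow, rowPath] <;> omega
  · split_ifs <;> simp only [elbow, rowPath] <;> omega

theorem isBendENPG_of_rowPaths {V : Type*} {G : SimpleGraph V} (M : ℕ) (y l r a b : V → ℤ)
    (hv : ∀ v, 0 ≤ y v ∧ y v < M ∧ 0 ≤ l v ∧ l v < r v ∧ r v < M ∧ (a v = 0 ∨ b v = 0) ∧
      0 ≤ y v + a v ∧ y v + a v < M ∧ 0 ≤ y v + b v ∧ y v + b v < M)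
    (h : ∀ u v, u ≠ v → (G.Adj u v ↔
      (rowPath (y u) (l u) (r u) (a u) (b u)).Linked (rowPath (y v) (l v) (r v) (a v) (b v)))) :
    IsBendENPG 1 G := by
  have hP : ∀ v, ∃ P : PathIn (grid M M), (bends P).encard ≤ 1 ∧
      ofEdges {e | e ∈ P.walk.edges} = rowPath (y v) (l v) (r v) (a v) (b v) := fun v => by
    have := hv v
    rw [rowPath_eq_elbow (by omega) (by omega)]
    split_ifs <;> apply exists_pathIn_elbow <;> omega
  choose P hb hP using hP
  refine ⟨M, M, P, hb, fun u v huv => ?_⟩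
  rw [nonSplitting_iff_linked, hP, hP, h u v huv]

/-- A path with left end `0` or `1` and core `[1, 2]`, ending before the other core or turning up
behind it, against a path with right end `N + 4` or `N + 3` and core `[N + 2, N + 3]`, ending behind
the first core or turning up before it. -/
theorem linked_along_row {N f g : ℤ} (hf : 0 ≤ f ∧ f ≤ N) (hg : 0 ≤ g ∧ g ≤ N) {α ρ γ β : Prop}
    [Decidable α] [Decidable ρ] [Decidable γ] [Decidable β] :
    (rowPath 0 (if α then 0 else 1) (if ρ then N + 3 else 2 + f) 0 (if ρ then 1 else 0)).Linked
      (rowPath 0 (if γ then 1 else N + 2 - g) (if β then N + 4 else N + 3)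
        (if γ then 1 else 0) 0) ↔
      (ρ ∨ γ ∨ N < f + g) ∧ ¬ (α ∧ γ) ∧ ¬ (ρ ∧ β) := by
  rw [linked_same_row (x := 1) (x' := N + 2) (by omega) (by split_ifs <;> omega)
    (by split_ifs <;> omega) (by split_ifs <;> omega) (by split_ifs <;> omega)]
  refine and_congr ?_ (and_congr (not_congr ?_) (not_congr ?_))
  · by_cases hρ : ρ <;> by_cases hγ : γ <;>
      simp only [hρ, hγ, if_true, if_false, true_or, or_true, false_or, iff_true] <;> omega
  · simp only [EndFork]
    by_cases hα : α <;> by_cases hγ : γ <;>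
      simp only [hα, hγ, if_true, if_false, and_self, and_false, false_and, iff_true,
        iff_false] <;> omega
  · simp only [EndFork]
    by_cases hρ : ρ <;> by_cases hβ : β <;>
      simp only [hρ, hβ, if_true, if_false, and_self, and_false, false_and, iff_true,
        iff_false] <;> omega

/-- Both cliques are placed along one row, with cores near its two ends. -/
theorem SingleRoute.isBendENPG {V : Type*} [Finite V] {G : SimpleGraph V} {K K' : Set V}
    (hcompl : IsCompl K K') (hK : G.IsClique K) (hK' : G.IsClique K')
    (h : SingleRoute K K' G.Adj) : IsBendENPG 1 G := by
  classical
  obtain ⟨C, α, γ, ρ, β, hC, h⟩ := h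
  obtain ⟨N, f, g, -, hf, hg, hfg⟩ := exists_thresholds (σ := fun _ => True) (τ := fun _ => True)
    (fun _ _ _ _ _ => Iff.rfl) (fun u₁ h1 u₂ h2 v₁ h3 v₂ h4 _ => hC u₁ h1 u₂ h2 v₁ h3 v₂ h4)
  have mem : ∀ v, v ∉ K → v ∈ K' := fun v hv => by
    rw [← hcompl.compl_eq]
    exact hv
  have hN : ∀ v, (0 ≤ (f v : ℤ) ∧ (f v : ℤ) ≤ N) ∧ (0 ≤ (g v : ℤ) ∧ (g v : ℤ) ≤ N) :=
    fun v => by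
      have := hf v
      have := hg v
      omega
  have cross : ∀ u ∈ K, ∀ v ∉ K, G.Adj u v ↔
      (rowPath 0 (if α u then 0 else 1) (if ρ u then N + 3 else 2 + f u) 0
        (if ρ u then 1 else 0)).Linked
      (rowPath 0 (if γ v then 1 else N + 2 - g v) (if β v then N + 4 else N + 3)
        (if γ v then 1 else 0) 0) := by
    intro u hu v hv
    obtain ⟨h1, h2, h3⟩ := h u hu v (mem v hv)
    have h4 := hfg u hu v (mem v hv) Iff.rfl
    rw [linked_along_row (hN u).1 (hN v).2, h1, ← Nat.cast_add, Nat.cast_lt, ← h4]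
    tauto
  refine isBendENPG_of_rowPaths (N + 5) (fun _ => 0)
    (fun v => if v ∈ K then if α v then 0 else 1 else if γ v then 1 else N + 2 - g v)
    (fun v => if v ∈ K then if ρ v then N + 3 else 2 + f v else if β v then N + 4 else N + 3)
    (fun v => if v ∈ K then 0 else if γ v then 1 else 0)
    (fun v => if v ∈ K then if ρ v then 1 else 0 else 0) (fun v => ?_) fun u v huv => ?_
  · have := hN v
    by_cases hvK : v ∈ K <;>
      simp only [hvK, if_true, if_false, Nat.cast_add, Nat.cast_ofNat] <;>
      refine ⟨?_, ?_, ?_, ?_, ?_, ?_, ?_, ?_, ?_, ?_⟩ <;> (try split_ifs) <;>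
        first | omega | simp
  · have := hN u
    have := hN v
    by_cases hu : u ∈ K <;> by_cases hv : v ∈ K <;> simp only [hu, hv, if_true, if_false]
    · refine iff_of_true (hK hu hv huv) ?_
      rw [linked_same_row (x := 1) (x' := 1) (by omega) (by split_ifs <;> omega)
        (by split_ifs <;> omega) (by split_ifs <;> omega) (by split_ifs <;> omega)]
      simp only [EndFork]
      refine ⟨?_, ?_, ?_⟩ <;> split_ifs <;> omega
    · exact cross u hu v hv
    · rw [G.adj_comm, linked_comm]
      exact cross v hv u hu
    · refine iff_of_true (hK' (mem u hu) (mem v hv) huv) ?_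
      rw [linked_same_row (x := N + 2) (x' := N + 2) (by omega) (by split_ifs <;> omega)
        (by split_ifs <;> omega) (by split_ifs <;> omega) (by split_ifs <;> omega)]
      simp only [EndFork]
      refine ⟨?_, ?_, ?_⟩ <;> split_ifs <;> omega

/-- The two cliques are represented by two `U`-shapes facing each other, whose legs overlap. -/
theorem TwoRoutes.isBendENPG {V : Type*} [Finite V] {G : SimpleGraph V} {K K' : Set V}
    (hcompl : IsCompl K K') (hK : G.IsClique K) (hK' : G.IsClique K')
    (h : TwoRoutes K K' G.Adj) : IsBendENPG 1 G := by
  classical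
  obtain ⟨σ, τ, hστ, h⟩ := h
  obtain ⟨N, f, g, hN0, hf, hg, hfg⟩ := exists_thresholds hστ h
  have mem : ∀ v, v ∉ K → v ∈ K' := fun v hv => by
    rw [← hcompl.compl_eq]
    exact hv
  have hN : ∀ v, (f v : ℤ) ≤ N ∧ (g v : ℤ) ≤ N := fun v => ⟨mod_cast hf v, mod_cast hg v⟩
  have cross : ∀ u ∈ K, ∀ v ∉ K, G.Adj u v ↔
      (rowPath 0 0 1 (if σ u then f u else 0) (if σ u then 0 else f u)).Linked
      (rowPath N 0 1 (if τ v then -g v else 0) (if τ v then 0 else -g v)) := by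
    intro u hu v hv
    have := hN u
    have := hN v
    rw [linked_rows_of_lt (by omega) (by omega) (by omega) (by split_ifs <;> simp)
      (by split_ifs <;> simp)]
    have h1 := hστ u hu v (mem v hv)
    have h2 := hfg u hu v (mem v hv)
    by_cases hσ : σ u <;> by_cases hτ : τ v <;>
      simp only [hσ, hτ, if_true, if_false, iff_true, iff_false, true_imp_iff, not_true]
        at h1 h2 ⊢
    · rw [h2]; split_ifs <;> omega
    · refine iff_of_false h1 ?_
      split_ifs <;> omega
    · refine iff_of_false h1 ?_
      split_ifs <;> omega
    · rw [h2]; simp only [true_and]; omega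
  refine isBendENPG_of_rowPaths (N + 2) (fun v => if v ∈ K then 0 else N) (fun _ => 0) (fun _ => 1)
    (fun v => if v ∈ K then if σ v then f v else 0 else if τ v then -g v else 0)
    (fun v => if v ∈ K then if σ v then 0 else f v else if τ v then 0 else -g v)
    (fun v => ?_) fun u v huv => ?_
  · have := hN v
    by_cases hvK : v ∈ K <;>
      simp only [hvK, if_true, if_false, Nat.cast_add, Nat.cast_ofNat] <;>
      refine ⟨?_, ?_, ?_, ?_, ?_, ?_, ?_, ?_, ?_, ?_⟩ <;> (try split_ifs) <;> omega
  · have := hN u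
    have := hN v
    by_cases hu : u ∈ K <;> by_cases hv : v ∈ K <;> simp only [hu, hv, if_true, if_false]
    · refine iff_of_true (hK hu hv huv) ?_
      rw [linked_same_row (x := 0) (x' := 0) (by omega) (by omega) (by omega) (by omega) (by omega)]
      simp only [EndFork]
      split_ifs <;> omega
    · exact cross u hu v hv
    · rw [G.adj_comm, linked_comm]
      exact cross v hv u hu
    · refine iff_of_true (hK' (mem u hu) (mem v hv) huv) ?_
      rw [linked_same_row (x := 0) (x' := 0) (by omega) (by omega) (by omega) (by omega) (by omega)]
      simp only [EndFork]
      split_ifs <;> omega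

/-- In a connected graph with a representation by one-bend paths, the adjacency between two
cliques has one of the two shapes. -/
theorem IsBendENPG.routes {V : Type*} [Finite V] {G : SimpleGraph V} {K K' : Set V}
    (hcompl : IsCompl K K') (hK : G.IsClique K) (hK' : G.IsClique K') (hconn : G.Connected)
    (h : IsBendENPG 1 G) : SingleRoute K K' G.Adj ∨ TwoRoutes K K' G.Adj := by
  have empty : ∀ {K K' : Set V}, (K = ∅ ∨ K' = ∅) → SingleRoute K K' G.Adj := fun h =>
    ⟨fun _ _ => True, fun _ => True, fun _ => True, fun _ => True, fun _ => True,
      fun _ _ _ _ _ _ _ _ _ _ => .inl trivial,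
      fun u hu v hv => by rcases h with rfl | rfl <;> contradiction⟩
  rcases K.eq_empty_or_nonempty with hne | hne
  · exact .inl (empty (.inl hne))
  rcases K'.eq_empty_or_nonempty with hne' | hne'
  · exact .inl (empty (.inr hne'))
  have hdis : ∀ u ∈ K, ∀ v ∈ K', u ≠ v := fun u hu v hv huv =>
    hcompl.disjoint.le_bot ⟨hu, huv ▸ hv⟩
  have : Nontrivial V := ⟨hne.some, hne'.some, hdis _ hne.some_mem _ hne'.some_mem⟩
  obtain ⟨m, n, P, hb, hadj⟩ := h
  let E : V → LatticeEdges := fun v => ofEdges {e | e ∈ (P v).walk.edges}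
  have hE : ∀ u v, u ≠ v → (G.Adj u v ↔ (E u).Linked (E v)) := fun u v huv => by
    rw [hadj u v huv, nonSplitting_iff_linked]
  have helbow : ∀ v, ∃ p q s t, E v = elbow p q s t := fun v => by
    obtain ⟨p, q, s, t, h, -⟩ := exists_elbow_of_walk (P v).walk (P v).isPath
      ((bends_encard_le_one_iff _).1 (hb v))
    exact ⟨p, q, s, t, h⟩
  choose p q s t helbow using helbow
  have hself : ∀ v, (E v).Linked (E v) := fun v => by
    obtain ⟨w, hw⟩ := hconn.preconnected.exists_adj_of_nontrivial v
    obtain ⟨⟨x, y, hm⟩, -⟩ := (hE v w hw.ne).1 hw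
    rw [helbow v] at hm ⊢
    apply linked_self_elbow
    simp only [elbow] at hm
    omega
  have hl : ∀ {K : Set V}, G.IsClique K → ∀ u ∈ K, ∀ v ∈ K, (E u).Linked (E v) :=
    fun hK u hu v hv => by
      rcases eq_or_ne u v with rfl | huv
      · exact hself u
      · exact (hE u v huv).1 (hK hu hv huv)
  refine (routes_of_cores (exists_core hne (fun u _ => helbow u) (hl hK))
    (exists_core hne' (fun u _ => helbow u) (hl hK')) (hl hK) (hl hK')).imp ?_ ?_
  · exact fun h => h.congr fun u hu v hv => hE u v (hdis u hu v hv)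
  · exact fun h => h.congr fun u hu v hv => hE u v (hdis u hu v hv)

/-! ### The two conditions on the bipartite graph -/

theorem between_adj_of_mem {V : Type*} {G : SimpleGraph V} {K K' : Set V} {u v : V} (hu : u ∈ K)
    (hv : v ∈ K') : (G.between K K').Adj u v ↔ G.Adj u v := by
  simp [between_adj, hu, hv]

theorem exists_adj_of_nontrivial_supp {V : Type*} {B : SimpleGraph V} {c : B.ConnectedComponent}
    (hc : c.supp.Nontrivial) : ∃ u v, B.Adj u v ∧ B.connectedComponentMk u = c := by
  have : Nontrivial c := hc.coe_sort
  obtain ⟨x, hx⟩ := hc.nonempty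
  obtain ⟨y, hy⟩ := c.connected_toSimpleGraph.preconnected.exists_adj_of_nontrivial ⟨x, hx⟩
  exact ⟨x, y, hy, hx⟩

theorem nontrivial_supp_of_adj {V : Type*} {B : SimpleGraph V} {u v : V} (h : B.Adj u v) :
    (B.connectedComponentMk u).supp.Nontrivial :=
  ⟨u, rfl, v, ConnectedComponent.sound h.reachable.symm, h.ne⟩

/-- The graph has at most two non-trivial components, and these are difference graphs. -/
def TwoDifferenceComponents {V : Type*} (B : SimpleGraph V) : Prop :=
  {c : B.ConnectedComponent | c.supp.Nontrivial}.encard ≤ 2 ∧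
    ∀ c : B.ConnectedComponent, c.supp.Nontrivial → IsDifferenceGraph c.toSimpleGraph

/-- The components with an edge are told apart by the route that their vertices use: two edges on
the same route are joined by a third one, because the relation is a chain there. -/
theorem TwoRoutes.twoDifferenceComponents {V : Type*} [Finite V] {G : SimpleGraph V}
    {K K' : Set V} (hcompl : IsCompl K K') (h : TwoRoutes K K' G.Adj) :
    TwoDifferenceComponents (G.between K K') := by
  classical
  obtain ⟨σ, τ, hστ, h⟩ := h
  have dis : ∀ {v}, v ∈ K → v ∉ K' := fun hv hv' => hcompl.disjoint.le_bot ⟨hv, hv'⟩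
  have mem : ∀ {v}, v ∉ K → v ∈ K' := fun {v} hv => by
    rw [← hcompl.compl_eq]
    exact hv
  let B := G.between K K'
  let s : V → Prop := fun v => v ∈ K ∧ σ v ∨ v ∈ K' ∧ τ v
  have hsK : ∀ {u}, u ∈ K → (s u ↔ σ u) := fun hu => by simp [s, hu, dis hu]
  have hsadj : ∀ {u v}, B.Adj u v → (s u ↔ s v) := by
    have main : ∀ {u v}, u ∈ K → v ∈ K' → G.Adj u v → (s u ↔ s v) := fun {u v} hu hv huv => by
      have hv' : v ∉ K := fun h => dis h hv
      simp [s, hu, hv, dis hu, hv', hστ u hu v hv huv]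
    rintro u v ⟨huv, ⟨hu, hv⟩ | ⟨hu, hv⟩⟩
    · exact main hu hv huv
    · exact (main hv hu huv.symm).symm
  have hs : ∀ {u v}, B.connectedComponentMk u = B.connectedComponentMk v → (s u ↔ s v) := by
    intro u v huv
    obtain ⟨w⟩ := ConnectedComponent.exact huv
    induction w with
    | nil => rfl
    | cons h w ih => exact (hsadj h).trans (ih (ConnectedComponent.sound w.reachable))
  have chain : ∀ {u₁ v₁ u₂ v₂}, u₁ ∈ K → u₂ ∈ K → v₁ ∈ K' → v₂ ∈ K' → (s u₁ ↔ s u₂) →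
      B.Adj u₁ v₁ → B.Adj u₂ v₂ → B.Adj u₁ v₂ ∨ B.Adj u₂ v₁ := by
    intro u₁ v₁ u₂ v₂ hu₁ hu₂ hv₁ hv₂ he h₁ h₂
    rw [hsK hu₁, hsK hu₂] at he
    rw [between_adj_of_mem hu₁ hv₂, between_adj_of_mem hu₂ hv₁]
    exact h u₁ hu₁ u₂ hu₂ v₁ hv₁ v₂ hv₂ he h₁.1 h₂.1
  have hrep : ∀ c : B.ConnectedComponent, c.supp.Nontrivial → ∃ u v, B.Adj u v ∧
      u ∈ K ∧ v ∈ K' ∧ B.connectedComponentMk u = c := by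
    intro c hc
    obtain ⟨u, v, huv, rfl⟩ := exists_adj_of_nontrivial_supp hc
    rcases huv.2 with ⟨hu, hv⟩ | ⟨hu, hv⟩
    · exact ⟨u, v, huv, hu, hv, rfl⟩
    · exact ⟨v, u, huv.symm, hv, hu, ConnectedComponent.sound huv.symm.reachable⟩
  constructor
  · let side : B.ConnectedComponent → Bool := fun c =>
      decide (∃ v, B.connectedComponentMk v = c ∧ s v)
    have hside : ∀ v, side (B.connectedComponentMk v) = true ↔ s v := fun v => by
      simp only [side, decide_eq_true_eq]
      exact ⟨fun ⟨w, hw, h⟩ => (hs hw).1 h, fun h => ⟨v, rfl, h⟩⟩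
    refine (Set.encard_le_encard_of_injOn (f := side) (t := Set.univ) (Set.mapsTo_univ _ _)
      ?_).trans (by rw [Set.encard_univ, ENat.card_eq_coe_fintype_card]; simp)
    intro c₁ hc₁ c₂ hc₂ he
    obtain ⟨u₁, v₁, h₁, hu₁, hv₁, rfl⟩ := hrep c₁ hc₁
    obtain ⟨u₂, v₂, h₂, hu₂, hv₂, rfl⟩ := hrep c₂ hc₂
    have he : s u₁ ↔ s u₂ := by rw [← hside, ← hside, he]
    rcases chain hu₁ hu₂ hv₁ hv₂ he h₁ h₂ with h' | h'
    · exact ConnectedComponent.sound (h'.reachable.trans h₂.symm.reachable)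
    · exact ConnectedComponent.sound (h₁.reachable.trans h'.symm.reachable)
  · intro c _
    refine IsChainOn.isDifferenceGraph (X := {v | v.1 ∈ K}) ?_ ?_
    · rintro u v ⟨-, ⟨hu, hv⟩ | ⟨hu, hv⟩⟩
      · exact iff_of_true hu fun h => dis h hv
      · exact iff_of_false (fun h => dis h hu) (not_not.2 hv)
    · intro u₁ hu₁ u₂ hu₂ v₁ hv₁ v₂ hv₂ h₁ h₂
      exact chain hu₁ hu₂ (mem hv₁) (mem hv₂) (hs (u₁.2.trans u₂.2.symm)) h₁ h₂

/-- The first route is given to one non-trivial component, the second one to everything else. -/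
theorem TwoDifferenceComponents.twoRoutes {V : Type*} {G : SimpleGraph V} {K K' : Set V}
    (hcompl : IsCompl K K') (h : TwoDifferenceComponents (G.between K K')) :
    TwoRoutes K K' G.Adj := by
  have dis : ∀ {v}, v ∈ K → v ∉ K' := fun hv hv' => hcompl.disjoint.le_bot ⟨hv, hv'⟩
  let B := G.between K K'
  obtain ⟨h2, hdiff⟩ := h
  have hadj : ∀ {u v}, u ∈ K → v ∈ K' → G.Adj u v → B.Adj u v := fun hu hv h =>
    (between_adj_of_mem hu hv).2 h
  by_cases hne : ∃ c₀ : B.ConnectedComponent, c₀.supp.Nontrivial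
  · obtain ⟨c₀, hc₀⟩ := hne
    refine ⟨fun v => B.connectedComponentMk v = c₀, fun v => B.connectedComponentMk v = c₀, ?_, ?_⟩
    · intro u hu v hv huv
      dsimp only
      rw [ConnectedComponent.sound (hadj hu hv huv).reachable]
    · intro u₁ hu₁ u₂ hu₂ v₁ hv₁ v₂ hv₂ hσ h₁ h₂
      have h₁ := hadj hu₁ hv₁ h₁
      have h₂ := hadj hu₂ hv₂ h₂
      have he : B.connectedComponentMk u₁ = B.connectedComponentMk u₂ := by
        by_contra hc
        have hc₁ : B.connectedComponentMk u₁ ≠ c₀ := fun h => hc (h.trans (hσ.1 h).symm)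
        have hc₂ : B.connectedComponentMk u₂ ≠ c₀ := fun h => hc ((hσ.2 h).trans h.symm)
        have h3 := Set.encard_eq_three.2 ⟨_, _, _, hc, hc₁, hc₂, rfl⟩
        have : (3 : ℕ∞) ≤ 2 := h3 ▸ (Set.encard_le_encard (by
          rintro c (rfl | rfl | rfl)
          · exact nontrivial_supp_of_adj h₁
          · exact nontrivial_supp_of_adj h₂
          · exact hc₀)).trans h2
        exact absurd this (by decide)
      have hv₁' : v₁ ∈ (B.connectedComponentMk u₁).supp :=
        ConnectedComponent.sound h₁.symm.reachable
      have hv₂' : v₂ ∈ (B.connectedComponentMk u₁).supp :=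
        (ConnectedComponent.sound h₂.symm.reachable).trans he.symm
      refine ((hdiff _ (nontrivial_supp_of_adj h₁)).adj_or_adj (u₁ := ⟨u₁, rfl⟩)
        (u₂ := ⟨u₂, he.symm⟩) (v₁ := ⟨v₁, hv₁'⟩) (v₂ := ⟨v₂, hv₂'⟩) h₁ h₂ ?_ ?_).imp
        (fun h => h.1) (fun h => h.1)
      · rintro ⟨-, ⟨-, h⟩ | ⟨h, -⟩⟩
        · exact dis hu₂ h
        · exact dis hu₁ h
      · rintro ⟨-, ⟨h, -⟩ | ⟨-, h⟩⟩
        · exact dis h hv₁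
        · exact dis h hv₂
  · have hno : ∀ u ∈ K, ∀ v ∈ K', ¬ G.Adj u v := fun u hu v hv huv =>
      hne ⟨_, nontrivial_supp_of_adj (hadj hu hv huv)⟩
    exact ⟨fun _ => True, fun _ => True, fun u hu v hv h => (hno u hu v hv h).elim,
      fun u₁ hu₁ u₂ hu₂ v₁ hv₁ v₂ hv₂ _ h _ => (hno u₁ hu₁ v₁ hv₁ h).elim⟩

/-- Deleting a bimodule that induces a zed leaves a difference graph. -/
def HasZedBimodule {V : Type*} (G : SimpleGraph V) (K K' : Set V) : Prop :=
  ∃ Z : Set V, IsZed (G.induce Z) ∧ IsBimodule (G.between K K') K K' Z ∧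
    IsDifferenceGraph ((G.between K K').induce Zᶜ)

/-- A zed contains no cycle of length four. -/
theorem IsZed.adj_of_adj {V : Type*} {G : SimpleGraph V} {Z : Set V} (hZ : IsZed (G.induce Z))
    {a b c d : V} (ha : a ∈ Z) (hb : b ∈ Z) (hc : c ∈ Z) (hd : d ∈ Z) (hab : G.Adj a b)
    (hbc : G.Adj b c) (hcd : G.Adj c d) (hac : a ≠ c) (hbd : b ≠ d) : ¬ G.Adj d a := by
  intro hda
  obtain ⟨φ⟩ := hZ
  have key : ∀ a b c d : Fin 4, (pathGraph 4).Adj a b → (pathGraph 4).Adj b c →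
      (pathGraph 4).Adj c d → (pathGraph 4).Adj d a → a = c ∨ b = d := by
    simp only [pathGraph_adj]
    decide
  have adj : ∀ (x y : Z), G.Adj x y → (pathGraph 4).Adj (φ x) (φ y) := fun x y h =>
    φ.map_rel_iff.2 h
  rcases key _ _ _ _ (adj ⟨a, ha⟩ ⟨b, hb⟩ hab) (adj ⟨b, hb⟩ ⟨c, hc⟩ hbc)
    (adj ⟨c, hc⟩ ⟨d, hd⟩ hcd) (adj ⟨d, hd⟩ ⟨a, ha⟩ hda) with h | h
  · exact hac (congrArg Subtype.val (φ.injective h))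
  · exact hbd (congrArg Subtype.val (φ.injective h))

/-- The vertices of the bimodule run past the far core, and everything else overlaps along the
route according to the difference graph. Inside the zed the adjacency between the cliques is given
by a condition on each end, since it contains no cycle of length four. -/
theorem HasZedBimodule.singleRoute {V : Type*} {G : SimpleGraph V} {K K' : Set V}
    (hcompl : IsCompl K K') (hK : G.IsClique K) (hK' : G.IsClique K')
    (h : HasZedBimodule G K K') : SingleRoute K K' G.Adj := by
  obtain ⟨Z, hZ, ⟨-, -, hbi⟩, hdiff⟩ := h
  have dis : ∀ {v}, v ∈ K → v ∉ K' := fun hv hv' => hcompl.disjoint.le_bot ⟨hv, hv'⟩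
  have hbi₁ : ∀ u ∈ K, u ∉ Z → ∀ v ∈ K', v ∈ Z →
      (G.Adj u v ↔ ¬ ∀ w ∈ K', w ∈ Z → ¬ G.Adj u w) := by
    intro u hu huZ v hv hvZ
    refine ⟨fun h hc => hc v hv hvZ h, fun hc => ?_⟩
    by_contra h
    push Not at hc
    obtain ⟨w, hw, hwZ, huw⟩ := hc
    exact hbi u (.inl ⟨⟨hu, huZ⟩, ⟨w, ⟨hwZ, hw⟩, (between_adj_of_mem hu hw).2 huw⟩,
      v, ⟨hvZ, hv⟩, fun h' => h h'.1⟩)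
  have hbi₂ : ∀ v ∈ K', v ∉ Z → ∀ u ∈ K, u ∈ Z →
      (G.Adj u v ↔ ¬ ∀ w ∈ K, w ∈ Z → ¬ G.Adj w v) := by
    intro v hv hvZ u hu huZ
    refine ⟨fun h hc => hc u hu huZ h, fun hc => ?_⟩
    by_contra h
    push Not at hc
    obtain ⟨w, hw, hwZ, hwv⟩ := hc
    exact hbi v (.inr ⟨⟨hv, hvZ⟩, ⟨w, ⟨hwZ, hw⟩, ((between_adj_of_mem hw hv).2 hwv).symm⟩,
      u, ⟨huZ, hu⟩, fun h' => h h'.1.symm⟩)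
  refine ⟨fun u v => u ∈ Z ∨ v ∈ Z ∨ G.Adj u v, fun u => ∀ w ∈ K', w ∈ Z → ¬ G.Adj u w,
    fun v => v ∈ Z, fun u => u ∈ Z, fun v => ∀ w ∈ K, w ∈ Z → ¬ G.Adj w v, ?_,
    fun u hu v hv => ⟨?_, fun h => .inl (.inl h), fun h => .inl (.inr (.inl h))⟩⟩
  · intro u₁ hu₁ u₂ hu₂ v₁ hv₁ v₂ hv₂ h₁ h₂
    by_cases hZ : u₁ ∈ Z ∨ u₂ ∈ Z ∨ v₁ ∈ Z ∨ v₂ ∈ Z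
    · dsimp only
      tauto
    · simp only [not_or] at hZ
      obtain ⟨z₁, z₂, z₃, z₄⟩ := hZ
      have h₁ := (h₁.resolve_left z₁).resolve_left z₃
      have h₂ := (h₂.resolve_left z₂).resolve_left z₄
      refine (hdiff.adj_or_adj (u₁ := ⟨u₁, z₁⟩) (u₂ := ⟨u₂, z₂⟩) (v₁ := ⟨v₁, z₃⟩)
        (v₂ := ⟨v₂, z₄⟩) ((between_adj_of_mem hu₁ hv₁).2 h₁) ((between_adj_of_mem hu₂ hv₂).2 h₂)
        ?_ ?_).imp (fun h => .inr (.inr h.1)) (fun h => .inr (.inr h.1))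
      · rintro ⟨-, ⟨-, h⟩ | ⟨h, -⟩⟩
        · exact dis hu₂ h
        · exact dis hu₁ h
      · rintro ⟨-, ⟨h, -⟩ | ⟨-, h⟩⟩
        · exact dis h hv₁
        · exact dis h hv₂
  · by_cases huZ : u ∈ Z <;> by_cases hvZ : v ∈ Z
    · constructor
      · exact fun h => ⟨.inl huZ, fun h' => h'.1 v hv hvZ h, fun h' => h'.2 u hu huZ h⟩
      · rintro ⟨-, h₁, h₂⟩
        have h₁ : ¬ ∀ w ∈ K', w ∈ Z → ¬ G.Adj u w := fun h => h₁ ⟨h, hvZ⟩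
        have h₂ : ¬ ∀ w ∈ K, w ∈ Z → ¬ G.Adj w v := fun h => h₂ ⟨huZ, h⟩
        push Not at h₁ h₂
        obtain ⟨v', hv', hvZ', huv'⟩ := h₁
        obtain ⟨u', hu', huZ', huv⟩ := h₂
        by_contra hn
        have huu : u ≠ u' := by
          rintro rfl
          exact hn huv
        have hvv : v ≠ v' := by
          rintro rfl
          exact hn huv'
        -- The vertices `u`, `u'`, `v`, `v'` would form a cycle of length four.
        refine hZ.adj_of_adj huZ huZ' hvZ hvZ' (hK hu hu' huu) huv (hK' hv hv' hvv) ?_ ?_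
          huv'.symm
        · rintro rfl
          exact dis hu hv
        · rintro rfl
          exact dis hu' hv'
    · rw [hbi₂ v hv hvZ u hu huZ]
      simp [huZ, hvZ]
    · rw [hbi₁ u hu huZ v hv hvZ]
      simp [huZ, hvZ]
    · simp [huZ, hvZ]

/-- The bimodule consists of the vertices whose paths run past the far core. Their adjacencies only
depend on the fork at the other end, so for want of twins each clique contributes at most two
of them, and they induce part of a path on four vertices. -/
theorem SingleRoute.hasZedBimodule {V : Type*} [Finite V] [Nonempty V] {G : SimpleGraph V}
    {K K' : Set V} (hcompl : IsCompl K K') (hK : G.IsClique K) (hK' : G.IsClique K')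
    (htwin : TwinFree G) (h : SingleRoute K K' G.Adj) : HasZedBimodule G K K' := by
  classical
  obtain ⟨C, α, γ, ρ, β, hC, h⟩ := h
  have dis : ∀ {v}, v ∈ K → v ∉ K' := fun hv hv' => hcompl.disjoint.le_bot ⟨hv, hv'⟩
  have mem : ∀ {v}, v ∉ K → v ∈ K' := fun {v} hv => by
    rw [← hcompl.compl_eq]
    exact hv
  have mem' : ∀ {v}, v ∉ K' → v ∈ K := fun {v} hv => by
    rw [← hcompl.symm.compl_eq]
    exact hv
  -- The paths that run past the far core, where only the forks matter.
  let Z₀ : Set V := {v | v ∈ K ∧ ρ v ∨ v ∈ K' ∧ γ v}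
  have hZK : ∀ {v}, v ∈ K → (v ∈ Z₀ ↔ ρ v) := fun {v} hv => by simp [Z₀, hv, dis hv]
  have hZK' : ∀ {v}, v ∈ K' → (v ∈ Z₀ ↔ γ v) := fun {v} hv => by
    have : v ∉ K := fun h => dis h hv
    simp [Z₀, hv, this]
  have diff : ∀ Z : Set V, Z₀ ⊆ Z → IsDifferenceGraph ((G.between K K').induce Zᶜ) := by
    intro Z hZ
    refine IsChainOn.isDifferenceGraph (X := {v | v.1 ∈ K}) ?_ ?_
    · rintro u v ⟨-, ⟨hu, hv⟩ | ⟨hu, hv⟩⟩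
      · exact iff_of_true hu fun h => dis h hv
      · exact iff_of_false (fun h => dis h hu) (not_not.2 hv)
    · have adj : ∀ {u v}, u ∈ K → v ∈ K' → u ∉ Z → v ∉ Z →
          ((G.between K K').Adj u v ↔ C u v) := by
        intro u v hu hv huZ hvZ
        have hρ : ¬ ρ u := fun h => huZ (hZ ((hZK hu).2 h))
        have hγ : ¬ γ v := fun h => hvZ (hZ ((hZK' hv).2 h))
        rw [between_adj_of_mem hu hv, (h u hu v hv).1]
        simp [hρ, hγ]
      intro u₁ hu₁ u₂ hu₂ v₁ hv₁ v₂ hv₂ h₁ h₂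
      exact (hC u₁ hu₁ u₂ hu₂ v₁ (mem hv₁) v₂ (mem hv₂)
        ((adj hu₁ (mem hv₁) u₁.2 v₁.2).1 h₁) ((adj hu₂ (mem hv₂) u₂.2 v₂.2).1 h₂)).imp
        (adj hu₁ (mem hv₂) u₁.2 v₂.2).2 (adj hu₂ (mem hv₁) u₂.2 v₁.2).2
  have h10 : ∀ {u v}, u ∈ K → v ∈ K' → ρ u → ¬ γ v → (G.Adj u v ↔ ¬ β v) := by
    intro u v hu hv hρ hγ
    have := h u hu v hv
    tauto
  have h01 : ∀ {u v}, u ∈ K → v ∈ K' → ¬ ρ u → γ v → (G.Adj u v ↔ ¬ α u) := by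
    intro u v hu hv hρ hγ
    have := h u hu v hv
    tauto
  have h11 : ∀ {u v}, u ∈ K → v ∈ K' → ρ u → γ v → (G.Adj u v ↔ ¬ α u ∧ ¬ β v) := by
    intro u v hu hv hρ hγ
    have := h u hu v hv
    tauto
  rcases Z₀.eq_empty_or_nonempty with he | hne
  · obtain ⟨x⟩ := ‹Nonempty V›
    refine ⟨{x}, ⟨⟨⟨fun _ => 0, fun a b _ => Subsingleton.elim a b⟩, fun {a b} => ?_⟩⟩,
      ⟨⟨x, rfl⟩, fun v _ => ?_, ?_⟩, diff _ (by simp [he])⟩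
    · rw [Subsingleton.elim a b]
      simp
    · by_cases hv : v ∈ K
      · exact .inl hv
      · exact .inr (mem hv)
    · rintro v (⟨-, ⟨w, ⟨rfl, -⟩, h1⟩, w', ⟨rfl, -⟩, h2⟩ |
        ⟨-, ⟨w, ⟨rfl, -⟩, h1⟩, w', ⟨rfl, -⟩, h2⟩) <;>
        exact h2 h1
  -- Members of a clique with the same neighbours in the other one are twins.
  have twin : ∀ {u w}, u ∈ K → w ∈ K → (∀ v ∈ K', G.Adj u v ↔ G.Adj w v) → u = w := by
    intro u w hu hw huw
    by_contra hne
    refine htwin u w (hK hu hw hne) (Set.ext fun v => ?_)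
    simp only [Set.mem_sdiff, mem_neighborSet, Set.mem_singleton_iff]
    by_cases hv : v ∈ K
    · have h1 : G.Adj u v ↔ u ≠ v := ⟨fun h => h.ne, hK hu hv⟩
      have h2 : G.Adj w v ↔ w ≠ v := ⟨fun h => h.ne, hK hw hv⟩
      rw [h1, h2, eq_comm (a := v), eq_comm (a := v)]
      exact and_comm
    · have h1 : v ≠ u := fun h => hv (h ▸ hu)
      have h2 : v ≠ w := fun h => hv (h ▸ hw)
      simp [huw v (mem hv), h1, h2]
  have twin' : ∀ {u w}, u ∈ K' → w ∈ K' → (∀ v ∈ K, G.Adj v u ↔ G.Adj v w) → u = w := by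
    intro u w hu hw huw
    by_contra hne
    refine htwin u w (hK' hu hw hne) (Set.ext fun v => ?_)
    simp only [Set.mem_sdiff, mem_neighborSet, Set.mem_singleton_iff]
    by_cases hv : v ∈ K'
    · have h1 : G.Adj u v ↔ u ≠ v := ⟨fun h => h.ne, hK' hu hv⟩
      have h2 : G.Adj w v ↔ w ≠ v := ⟨fun h => h.ne, hK' hw hv⟩
      rw [h1, h2, eq_comm (a := v), eq_comm (a := v)]
      exact and_comm
    · have h1 : v ≠ u := fun h => hv (h ▸ hu)
      have h2 : v ≠ w := fun h => hv (h ▸ hw)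
      simp [G.adj_comm u, G.adj_comm w, huw v (mem' hv), h1, h2]
  have inj : ∀ {u w}, u ∈ K → w ∈ K → ρ u → ρ w → (α u ↔ α w) → u = w := by
    intro u w hu hw hρ hρ' hα
    refine twin hu hw fun v hv => ?_
    by_cases hγ : γ v
    · rw [h11 hu hv hρ hγ, h11 hw hv hρ' hγ, hα]
    · rw [h10 hu hv hρ hγ, h10 hw hv hρ' hγ]
  have inj' : ∀ {u w}, u ∈ K' → w ∈ K' → γ u → γ w → (β u ↔ β w) → u = w := by
    intro u w hu hw hγ hγ' hβ
    refine twin' hu hw fun v hv => ?_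
    by_cases hρ : ρ v
    · rw [h11 hv hu hρ hγ, h11 hv hw hρ hγ', hβ]
    · rw [h01 hv hu hρ hγ, h01 hv hw hρ hγ']
  refine ⟨Z₀, ?_, ⟨hne, fun v hv => hv.imp And.left And.left, ?_⟩, diff _ subset_rfl⟩
  · -- The position on the path on four vertices is given by the clique and the fork.
    let φ : V → Fin 4 := fun v => if v ∈ K then if α v then 0 else 1 else if β v then 3 else 2
    have hφ : ∀ u ∈ Z₀, ∀ v ∈ Z₀, (φ u = φ v → u = v) ∧
        ((pathGraph 4).Adj (φ u) (φ v) ↔ G.Adj u v) := by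
      intro u hu v hv
      by_cases huK : u ∈ K <;> by_cases hvK : v ∈ K
      · have hi := inj huK hvK ((hZK huK).1 hu) ((hZK hvK).1 hv)
        have ha : G.Adj u v ↔ u ≠ v := ⟨fun h => h.ne, hK huK hvK⟩
        rw [ha]
        rcases eq_or_ne u v with rfl | huv
        · simp
        by_cases h1 : α u <;> by_cases h2 : α v <;>
          simp [φ, huK, hvK, h1, h2, pathGraph_adj, huv] at hi ⊢
      · have hx := h11 huK (mem hvK) ((hZK huK).1 hu) ((hZK' (mem hvK)).1 hv)
        rw [hx]
        by_cases h1 : α u <;> by_cases h2 : β v <;>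
          simp [φ, huK, hvK, h1, h2, pathGraph_adj]
      · have hx := h11 hvK (mem huK) ((hZK hvK).1 hv) ((hZK' (mem huK)).1 hu)
        rw [G.adj_comm, hx]
        by_cases h1 : α v <;> by_cases h2 : β u <;>
          simp [φ, huK, hvK, h1, h2, pathGraph_adj]
      · have hi := inj' (mem huK) (mem hvK) ((hZK' (mem huK)).1 hu) ((hZK' (mem hvK)).1 hv)
        have ha : G.Adj u v ↔ u ≠ v := ⟨fun h => h.ne, hK' (mem huK) (mem hvK)⟩
        rw [ha]
        rcases eq_or_ne u v with rfl | huv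
        · simp
        by_cases h1 : β u <;> by_cases h2 : β v <;>
          simp [φ, huK, hvK, h1, h2, pathGraph_adj, huv] at hi ⊢
    exact ⟨⟨⟨fun v => φ v, fun u v huv => Subtype.ext ((hφ u u.2 v v.2).1 huv)⟩,
      fun {u v} => (hφ u u.2 v v.2).2⟩⟩
  · rintro v (⟨⟨hv, hvZ⟩, ⟨w, ⟨hwZ, hw⟩, h1⟩, w', ⟨hwZ', hw'⟩, h2⟩ |
      ⟨⟨hv, hvZ⟩, ⟨w, ⟨hwZ, hw⟩, h1⟩, w', ⟨hwZ', hw'⟩, h2⟩)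
    · rw [hZK hv] at hvZ
      rw [between_adj_of_mem hv hw, h01 hv hw hvZ ((hZK' hw).1 hwZ)] at h1
      rw [between_adj_of_mem hv hw', h01 hv hw' hvZ ((hZK' hw').1 hwZ')] at h2
      exact h2 h1
    · rw [hZK' hv] at hvZ
      rw [adj_comm, between_adj_of_mem hw hv, h10 hw hv ((hZK hw).1 hwZ) hvZ] at h1
      rw [adj_comm, between_adj_of_mem hw' hv, h10 hw' hv ((hZK hw').1 hwZ') hvZ] at h2
      exact h2 h1

end ENPG

/-- Here `G.between K K'` is the bipartite graph on the vertices of `G` formed by the edges of `G`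
that join a vertex of `K` to a vertex of `K'`. -/
theorem mainTheorem3 {V : Type*} [Finite V] (G : SimpleGraph V) (K K' : Set V)
    (hcompl : IsCompl K K') (hK : G.IsClique K) (hK' : G.IsClique K')
    (hconn : G.Connected) (htwin : ENPG.TwinFree G) :
    ENPG.IsBendENPG 1 G ↔
      ({c : (G.between K K').ConnectedComponent | c.supp.Nontrivial}.encard ≤ 2 ∧
        ∀ c : (G.between K K').ConnectedComponent, c.supp.Nontrivial →
          ENPG.IsDifferenceGraph c.toSimpleGraph) ∨
      (∃ Z : Set V, ENPG.IsZed (G.induce Z) ∧ ENPG.IsBimodule (G.between K K') K K' Z ∧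
        ENPG.IsDifferenceGraph ((G.between K K').induce Zᶜ)) := by
  have := hconn.nonempty
  constructor
  · intro h
    rcases h.routes hcompl hK hK' hconn with h | h
    · exact .inr (h.hasZedBimodule hcompl hK hK' htwin)
    · exact .inl (h.twoDifferenceComponents hcompl)
  · rintro (h | h)
    · exact (ENPG.TwoDifferenceComponents.twoRoutes hcompl h).isBendENPG hcompl hK hK'
    · exact (ENPG.HasZedBimodule.singleRoute hcompl hK hK' h).isBendENPG hcompl hK hK'
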